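/- Let $M$ be a connected $C^\infty$ manifold of dimension $n>2$ with a smooth metric $g$ (nondegenerate, of any signature), Christoffel symbols $\Gamma^i_{jk}$, Ricci tensor $R_{ij}$ and curvature scalar $R=g^{ij}R_{ij}$, and suppose that $(M,g)$ is a proper Einstein space, i.e. $R_{ij}=\frac{R}{n}g_{ij}$ with $R\neq 0$. A smooth vector field $X=\xi(t,x)\partial_t+\eta^i(t,x)\partial_i$ on $J\times M$, $J\subseteq\mathbb R$ an open interval, is called a Lie point symmetry of the geodesic equations $\ddot x^i+\Gamma^i_{jk}\dot x^j\dot x^k=0$ if in all local coordinates there is a function $\lambda$ of $(t,x,\dot x)$ with $[X^{[1]},\mathbf A]=\lambda\mathbf A$, where $\mathbf A=\partial_t+\dot x^i\partial_i-\Gamma^i_{jk}\dot x^j\dot x^k\,\partial_{\dot x^i}$, $X^{[1]}=\xi\partial_t+\eta^i\partial_i+\bigl(\frac{d\eta^i}{dt}-\dot x^i\frac{d\xi}{dt}\bigr)\partial_{\dot x^i}$ and $\frac{d}{dt}=\partial_t+\dot x^j\partial_j$. Then: (1) $X$ is a Lie point symmetry of the geodesic equations if and only if $$X=(Kt+L)\,\partial_t+D^i(x)\,\partial_i$$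 with constants $K,L$ and a non-gradient Killing vector field $D$ on $M$ (smooth, $\mathcal L_Dg=0$, and $D$ is not locally a gradient unless $D=0$; $D=0$ is allowed). (2) $(M,g)$ admits no homothetic vector fields, affine collineations or special projective collineations other than Killing vector fields, and no gradient Killing vector fields except $0$. That is, for every smooth vector field $Y$ on $M$: if $\mathcal L_Yg=2\psi g$ with a constant $\psi$, then $\psi=0$; if $\mathcal L_Y\Gamma^i_{jk}=0$, then $\mathcal L_Yg=0$; if locally $\mathcal L_Y\Gamma^i_{jk}=f_{,j}\delta^i_k+f_{,k}\delta^i_j$ with a smooth function $f$ such that $f_{;jk}=0$, then $\mathcal L_Yg=0$; if $\mathcal L_Yg=0$ and locally $Y_i=S_{,i}$ with a smooth function $S$, then $Y=0$. -/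

import Mathlib

open scoped Manifold ContDiff

noncomputable section

namespace GeodesicSymmetry

/-- The coordinate space `ℝⁿ`. -/
abbrev Coord (n : ℕ) : Type := EuclideanSpace ℝ (Fin n)

/-- A smooth pseudo-Riemannian metric (nondegenerate, of arbitrary signature) on a manifold. -/
structure PseudoRiemannianMetric (n : ℕ) (M : Type*) [TopologicalSpace M]
    [ChartedSpace (Coord n) M] [IsManifold (𝓡 n) ∞ M] where
  inner (x : M) : TangentSpace (𝓡 n) x →L[ℝ] TangentSpace (𝓡 n) x →L[ℝ] ℝ
  symm (x : M) (v w : TangentSpace (𝓡 n) x) : inner x v w = inner x w v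
  nondegenerate (x : M) (v : TangentSpace (𝓡 n) x) (hv : ∀ w, inner x v w = 0) : v = 0
  contMDiff : ContMDiff (𝓡 n) ((𝓡 n).prod 𝓘(ℝ, Coord n →L[ℝ] Coord n →L[ℝ] ℝ)) ∞
    (fun x => Bundle.TotalSpace.mk' (Coord n →L[ℝ] Coord n →L[ℝ] ℝ)
      (E := fun x : M => TangentSpace (𝓡 n) x →L[ℝ] TangentSpace (𝓡 n) x →L[ℝ] ℝ)
      x (inner x))

/-- The partial derivative `∂ᵢ f` of a function of the coordinates. -/
def pd {n : ℕ} (i : Fin n) (f : Coord n → ℝ) (y : Coord n) : ℝ :=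
  fderiv ℝ f y (EuclideanSpace.single i 1)

section Christoffel

variable {n : ℕ}

/-- The Christoffel symbols `Γⁱⱼₖ = ½ gⁱˡ (∂ⱼ gₗₖ + ∂ₖ gₗⱼ - ∂ₗ gⱼₖ)` of a field of symmetric
matrices on the coordinate space. -/
def christoffel (G : Coord n → Matrix (Fin n) (Fin n) ℝ) (i j k : Fin n) (y : Coord n) : ℝ :=
  (1 / 2) * ∑ l, (G y)⁻¹ i l *
    (pd j (fun z => G z l k) y + pd k (fun z => G z l j) y - pd l (fun z => G z j k) y)

/-- The Ricci tensor
`Rⱼₖ = ∂ᵢ Γⁱⱼₖ - ∂ₖ Γⁱⱼᵢ + Γⁱᵢₗ Γˡⱼₖ - Γⁱₖₗ Γˡⱼᵢ`. -/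
def ricci (G : Coord n → Matrix (Fin n) (Fin n) ℝ) (j k : Fin n) (y : Coord n) : ℝ :=
  ∑ i, (pd i (christoffel G i j k) y - pd k (christoffel G i j i) y
    + ∑ l, (christoffel G i i l y * christoffel G l j k y
      - christoffel G i k l y * christoffel G l j i y))

/-- The curvature scalar `R = gʲᵏ Rⱼₖ`. -/
def scalarCurvature (G : Coord n → Matrix (Fin n) (Fin n) ℝ) (y : Coord n) : ℝ :=
  ∑ j, ∑ k, (G y)⁻¹ j k * ricci G j k y

/-- The Lie derivative of the metric,
`(L_X g)ᵢⱼ = Xᵏ ∂ₖ gᵢⱼ + gₖⱼ ∂ᵢ Xᵏ + gᵢₖ ∂ⱼ Xᵏ`. -/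
def lieDerivMetric (G : Coord n → Matrix (Fin n) (Fin n) ℝ) (X : Coord n → Coord n)
    (i j : Fin n) (y : Coord n) : ℝ :=
  ∑ k, (X y k * pd k (fun z => G z i j) y + G y k j * pd i (fun z => X z k) y
    + G y i k * pd j (fun z => X z k) y)

/-- The Lie derivative of the connection,
`L_X Γⁱⱼₖ = ∂ⱼ ∂ₖ Xⁱ + Xˡ ∂ₗ Γⁱⱼₖ + Γⁱₗⱼ ∂ₖ Xˡ + Γⁱₗₖ ∂ⱼ Xˡ - Γˡⱼₖ ∂ₗ Xⁱ`. -/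
def lieDerivConnection (G : Coord n → Matrix (Fin n) (Fin n) ℝ) (X : Coord n → Coord n)
    (i j k : Fin n) (y : Coord n) : ℝ :=
  pd j (pd k (fun z => X z i)) y
    + ∑ l, (X y l * pd l (christoffel G i j k) y
      + christoffel G i l j y * pd k (fun z => X z l) y
      + christoffel G i l k y * pd j (fun z => X z l) y
      - christoffel G l j k y * pd l (fun z => X z i) y)

/-- The second covariant derivative `f_{;jk} = ∂ⱼ ∂ₖ f - Γⁱⱼₖ ∂ᵢ f` of a function. -/
def covHessian (G : Coord n → Matrix (Fin n) (Fin n) ℝ) (f : Coord n → ℝ)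
    (j k : Fin n) (y : Coord n) : ℝ :=
  pd j (pd k f) y - ∑ i, christoffel G i j k y * pd i f y

/-! ### The jet space: points are `(t, y, v)` with `v` standing for `dy/dt`. -/

/-- The total derivative `df/dt = ∂f/∂t + vʲ ∂f/∂yʲ` of a function of `(t, y)`. -/
def totalDeriv {F : Type*} [NormedAddCommGroup F] [NormedSpace ℝ F] (f : ℝ × Coord n → F)
    (p : ℝ × Coord n × Coord n) : F :=
  fderiv ℝ f (p.1, p.2.1) (1, p.2.2)

/-- The right-hand side `ωⁱ = - Γⁱⱼₖ vʲ vᵏ` of the geodesic equations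
`d²yⁱ/dt² = ωⁱ(y, dy/dt)`, in an affine parameter. -/
def geodesicRHS (G : Coord n → Matrix (Fin n) (Fin n) ℝ) (y v : Coord n) : Coord n :=
  WithLp.toLp 2 fun i => - ∑ j, ∑ k, christoffel G i j k y * v j * v k

/-- The operator `A = ∂/∂t + vⁱ ∂/∂yⁱ + ωⁱ ∂/∂vⁱ` of the geodesic equations, as a vector field on
the jet space. -/
def geodesicOperator (G : Coord n → Matrix (Fin n) (Fin n) ℝ)
    (p : ℝ × Coord n × Coord n) : ℝ × Coord n × Coord n :=
  (1, p.2.2, geodesicRHS G p.2.1 p.2.2)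

/-- The first prolongation `ξ ∂/∂t + ηⁱ ∂/∂yⁱ + (dηⁱ/dt - vⁱ dξ/dt) ∂/∂vⁱ` of the vector field
`ξ(t, y) ∂/∂t + ηⁱ(t, y) ∂/∂yⁱ`. -/
def firstProlongation (ξ : ℝ × Coord n → ℝ) (η : ℝ × Coord n → Coord n)
    (p : ℝ × Coord n × Coord n) : ℝ × Coord n × Coord n :=
  (ξ (p.1, p.2.1), η (p.1, p.2.1), totalDeriv η p - totalDeriv ξ p • p.2.2)

end Christoffel

section Manifold

variable {n : ℕ} {M : Type*} [TopologicalSpace M] [ChartedSpace (Coord n) M]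

/-- The components `Xⁱ` of a vector field in the local coordinates `e`. -/
def vecCoord (e : OpenPartialHomeomorph M (Coord n)) (X : ∀ x : M, TangentSpace (𝓡 n) x)
    (y : Coord n) : Coord n :=
  mfderiv (𝓡 n) (𝓡 n) e (e.symm y) (X (e.symm y))

variable [IsManifold (𝓡 n) ∞ M]

/-- The components `gᵢⱼ = g(∂ᵢ, ∂ⱼ)` of the metric in the local coordinates `e`. -/
def metricCoord (g : PseudoRiemannianMetric n M) (e : OpenPartialHomeomorph M (Coord n))
    (y : Coord n) : Matrix (Fin n) (Fin n) ℝ :=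
  Matrix.of fun i j => g.inner (e.symm y)
    (mfderiv (𝓡 n) (𝓡 n) e.symm y (EuclideanSpace.single i (1 : ℝ) : Coord n))
    (mfderiv (𝓡 n) (𝓡 n) e.symm y (EuclideanSpace.single j (1 : ℝ) : Coord n))

/-- `(M, g)` is a proper Einstein space: `Rⱼₖ = (R / n) gⱼₖ` with `R ≠ 0`, in all local
coordinates. -/
def IsProperEinstein (g : PseudoRiemannianMetric n M) : Prop :=
  ∀ e ∈ IsManifold.maximalAtlas (𝓡 n) ∞ M, ∀ y ∈ e.target,
    (∀ j k, ricci (metricCoord g e) j k y =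
      scalarCurvature (metricCoord g e) y / n * metricCoord g e y j k) ∧
    scalarCurvature (metricCoord g e) y ≠ 0

/-- `X` is a smooth vector field. -/
def IsSmoothField (X : ∀ x : M, TangentSpace (𝓡 n) x) : Prop :=
  ContMDiff (𝓡 n) (𝓡 n).tangent ∞ (fun x => (⟨x, X x⟩ : TangentBundle (𝓡 n) M))

/-- `X` is a homothetic vector field with (constant) homothetic factor `ψ`: `L_X g = 2 ψ g`. -/
def IsHomothetic (g : PseudoRiemannianMetric n M) (X : ∀ x : M, TangentSpace (𝓡 n) x)
    (ψ : ℝ) : Prop :=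
  IsSmoothField X ∧ ∀ e ∈ IsManifold.maximalAtlas (𝓡 n) ∞ M, ∀ y ∈ e.target, ∀ i j,
    lieDerivMetric (metricCoord g e) (vecCoord e X) i j y = 2 * ψ * metricCoord g e y i j

/-- `X` is a Killing vector field: `L_X g = 0`. -/
def IsKilling (g : PseudoRiemannianMetric n M) (X : ∀ x : M, TangentSpace (𝓡 n) x) : Prop :=
  IsSmoothField X ∧ ∀ e ∈ IsManifold.maximalAtlas (𝓡 n) ∞ M, ∀ y ∈ e.target, ∀ i j,
    lieDerivMetric (metricCoord g e) (vecCoord e X) i j y = 0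

/-- `X` is locally a gradient: near every point there is a smooth function `S` such that
`gᵢⱼ Xʲ = ∂ᵢ S`. -/
def IsGradient (g : PseudoRiemannianMetric n M) (X : ∀ x : M, TangentSpace (𝓡 n) x) : Prop :=
  ∀ x : M, ∃ (U : Set M) (S : M → ℝ), IsOpen U ∧ x ∈ U ∧ ContMDiffOn (𝓡 n) 𝓘(ℝ, ℝ) ∞ S U ∧
    ∀ e ∈ IsManifold.maximalAtlas (𝓡 n) ∞ M, ∀ y ∈ e.target, e.symm y ∈ U → ∀ i,
      ∑ j, metricCoord g e y i j * vecCoord e X y j = pd i (fun z => S (e.symm z)) y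

/-- `X` is a gradient Killing vector field. -/
def IsGradientKilling (g : PseudoRiemannianMetric n M) (X : ∀ x : M, TangentSpace (𝓡 n) x) :
    Prop :=
  IsKilling g X ∧ IsGradient g X

/-- `X` is a non-gradient Killing vector field; the zero field is admitted. -/
def IsNonGradientKilling (g : PseudoRiemannianMetric n M)
    (X : ∀ x : M, TangentSpace (𝓡 n) x) : Prop :=
  IsKilling g X ∧ ((∃ x, X x ≠ 0) → ¬ IsGradient g X)

/-- `X` is an affine collineation: `L_X Γⁱⱼₖ = 0`. -/
def IsAffineCollineation (g : PseudoRiemannianMetric n M)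
    (X : ∀ x : M, TangentSpace (𝓡 n) x) : Prop :=
  IsSmoothField X ∧ ∀ e ∈ IsManifold.maximalAtlas (𝓡 n) ∞ M, ∀ y ∈ e.target, ∀ i j k,
    lieDerivConnection (metricCoord g e) (vecCoord e X) i j k y = 0

/-- `X` is a special projective collineation: near every point there is a smooth (projective)
function `f` with `L_X Γⁱⱼₖ = ∂ⱼ f δⁱₖ + ∂ₖ f δⁱⱼ` and `f_{;jk} = 0`. -/
def IsSpecialProjectiveCollineation (g : PseudoRiemannianMetric n M)
    (X : ∀ x : M, TangentSpace (𝓡 n) x) : Prop :=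
  IsSmoothField X ∧
  ∀ x : M, ∃ (U : Set M) (f : M → ℝ), IsOpen U ∧ x ∈ U ∧ ContMDiffOn (𝓡 n) 𝓘(ℝ, ℝ) ∞ f U ∧
    ∀ e ∈ IsManifold.maximalAtlas (𝓡 n) ∞ M, ∀ y ∈ e.target, e.symm y ∈ U →
      (∀ i j k, lieDerivConnection (metricCoord g e) (vecCoord e X) i j k y =
        pd j (fun z => f (e.symm z)) y * (if i = k then 1 else 0)
          + pd k (fun z => f (e.symm z)) y * (if i = j then 1 else 0)) ∧
      ∀ j k, covHessian (metricCoord g e) (fun z => f (e.symm z)) j k y = 0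

/-- The smooth vector field `ξ(t, x) ∂/∂t + ηⁱ(t, x) ∂/∂xⁱ` on `J × M` (with `J` an open set of
parameter values) is a Lie point symmetry of the geodesic equations of `g`: in all local
coordinates `[X^{[1]}, A] = lam A` for some function `lam` on the jet space. -/
def IsLiePointSymmetry (g : PseudoRiemannianMetric n M) (J : Set ℝ) (ξ : ℝ → M → ℝ)
    (η : ℝ → ∀ x : M, TangentSpace (𝓡 n) x) : Prop :=
  ContMDiffOn (𝓘(ℝ, ℝ).prod (𝓡 n)) 𝓘(ℝ, ℝ) ∞ (fun p : ℝ × M => ξ p.1 p.2) (J ×ˢ Set.univ) ∧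
  ContMDiffOn (𝓘(ℝ, ℝ).prod (𝓡 n)) (𝓡 n).tangent ∞
    (fun p : ℝ × M => (⟨p.2, η p.1 p.2⟩ : TangentBundle (𝓡 n) M)) (J ×ˢ Set.univ) ∧
  ∀ e ∈ IsManifold.maximalAtlas (𝓡 n) ∞ M, ∃ lam : ℝ × Coord n × Coord n → ℝ,
    ∀ t ∈ J, ∀ y ∈ e.target, ∀ v : Coord n,
      VectorField.lieBracket ℝ
        (firstProlongation (fun q => ξ q.1 (e.symm q.2)) (fun q => vecCoord e (η q.1) q.2))
        (geodesicOperator (metricCoord g e)) (t, y, v) =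
      lam (t, y, v) • geodesicOperator (metricCoord g e) (t, y, v)

end Manifold

end GeodesicSymmetry

end

open GeodesicSymmetry

/-! The Ricci tensor is `ρ g` with `ρ = R / n`, and for `n > 2` Schur's lemma (`schur`) makes `ρ`
locally constant: the second Bianchi identity, traced twice, reduces to `(n - 2) dρ = 0`. Since
moreover `ρ ≠ 0`, two facts follow, and they carry everything else.

(a) A field preserving the connection preserves the curvature, hence the Ricci tensor `ρ g`, hence
`g`: affine collineations are Killing (`killing_of_affine`). (b) If `∇Z = c·id` with `c` constant,
the Ricci identity gives `Ric(Z, ·) = 0`, so `ρ Z = 0` and `Z = 0` (`eq_zero_of_covVec`). In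
particular there are no nonzero parallel fields.

Part (2): homothetic fields are affine, hence Killing, which forces `ψ = 0`. A function with zero
Hessian has a parallel gradient, so its differential vanishes; thus special projective collineations
are affine. For a gradient Killing field `∇Y` is both symmetric and skew, so `Y` is parallel and
vanishes.

Part (1): in `[X^{[1]}, A] = λ A` the `∂_t` component forces `λ = -dξ/dt`, the `∂_x` components then
agree, and the velocity components leave a cubic polynomial in the velocity (`determining`). Its
cubic part gives `Hess ξ = 0`, so `ξ` depends on `t` only. The quadratic part then says `L_η Γ = 0`,
so every `η(t, ·)` is Killing by (a). The linear part is `∇η_t = ½ ξ_tt·id`, so `η_t = 0` by (b),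
and then `ξ_tt = 0`. Connectedness of `M` and of `J` turns these local facts into the global form.

The tensor calculus is carried out over a commutative `ℝ`-algebra with commuting derivations. The
connection is a family of matrices `Γ k` with entries `Γ k i j = Γⁱⱼₖ`, so that most identities are
noncommutative matrix identities and index sums appear only when traces are taken. The algebra is
later taken to be the smooth functions on an open set of the coordinate space. -/

namespace GeodesicSymmetry

/-! ### Matrix-valued connections over a ring with derivations: curvature and Bianchi identity. -/

section CurvatureAlgebra

variable {R : Type*} [CommRing R] [Algebra ℝ R] {n : ℕ}

/-- A derivation acting on matrices entrywise. -/
def matDeriv (d : Derivation ℝ R R) : Matrix (Fin n) (Fin n) R →+ Matrix (Fin n) (Fin n) R :=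
  d.toLinearMap.toAddMonoidHom.mapMatrix

theorem matDeriv_apply (d : Derivation ℝ R R) (X : Matrix (Fin n) (Fin n) R) (i j : Fin n) :
    matDeriv d X i j = d (X i j) := rfl

theorem matDeriv_mul (d : Derivation ℝ R R) (X Y : Matrix (Fin n) (Fin n) R) :
    matDeriv d (X * Y) = matDeriv d X * Y + X * matDeriv d Y := by
  ext i j
  simp only [matDeriv_apply, Matrix.mul_apply, Matrix.add_apply, map_sum, Derivation.leibniz,
    smul_eq_mul, ← Finset.sum_add_distrib]
  refine Finset.sum_congr rfl fun k _ => ?_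
  ring

theorem matDeriv_smul (d : Derivation ℝ R R) (r : R) (X : Matrix (Fin n) (Fin n) R) :
    matDeriv d (r • X) = d r • X + r • matDeriv d X := by
  ext i j
  simp only [matDeriv_apply, Matrix.smul_apply, Matrix.add_apply, Derivation.leibniz, smul_eq_mul]
  ring

theorem matDeriv_transpose (d : Derivation ℝ R R) (X : Matrix (Fin n) (Fin n) R) :
    matDeriv d X.transpose = (matDeriv d X).transpose := rfl

/-- The curvature `∂ₖ Γₗ - ∂ₗ Γₖ + [Γₖ, Γₗ]` of a matrix-valued connection form. -/
def curvForm (δ : Fin n → Derivation ℝ R R) (Γ : Fin n → Matrix (Fin n) (Fin n) R)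
    (k l : Fin n) : Matrix (Fin n) (Fin n) R :=
  matDeriv (δ k) (Γ l) - matDeriv (δ l) (Γ k) + Γ k * Γ l - Γ l * Γ k

/-- The Ricci contraction of the curvature form. -/
def ricForm (δ : Fin n → Derivation ℝ R R) (Γ : Fin n → Matrix (Fin n) (Fin n) R)
    (j k : Fin n) : R :=
  ∑ i, curvForm δ Γ i k i j

/-- The covariant derivative of an endomorphism. -/
def covEnd (δ : Fin n → Derivation ℝ R R) (Γ : Fin n → Matrix (Fin n) (Fin n) R)
    (m : Fin n) (X : Matrix (Fin n) (Fin n) R) : Matrix (Fin n) (Fin n) R :=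
  matDeriv (δ m) X + Γ m * X - X * Γ m

variable {δ : Fin n → Derivation ℝ R R} {Γ : Fin n → Matrix (Fin n) (Fin n) R}

theorem matDeriv_comm (hδ : ∀ i j f, δ i (δ j f) = δ j (δ i f)) (k l : Fin n)
    (X : Matrix (Fin n) (Fin n) R) :
    matDeriv (δ k) (matDeriv (δ l) X) = matDeriv (δ l) (matDeriv (δ k) X) := by
  ext i j; exact hδ _ _ _

theorem curvForm_swap (k l : Fin n) : curvForm δ Γ l k = - curvForm δ Γ k l := by
  unfold curvForm; abel

theorem covEnd_neg (m : Fin n) (X : Matrix (Fin n) (Fin n) R) :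
    covEnd δ Γ m (-X) = - covEnd δ Γ m X := by
  unfold covEnd; rw [map_neg]; noncomm_ring

theorem covEnd_add (m : Fin n) (X Y : Matrix (Fin n) (Fin n) R) :
    covEnd δ Γ m (X + Y) = covEnd δ Γ m X + covEnd δ Γ m Y := by
  unfold covEnd; rw [map_add]; noncomm_ring

theorem covEnd_smul (m : Fin n) (r : R) (X : Matrix (Fin n) (Fin n) R) :
    covEnd δ Γ m (r • X) = δ m r • X + r • covEnd δ Γ m X := by
  unfold covEnd
  rw [matDeriv_smul, mul_smul_comm, smul_mul_assoc]
  module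

theorem covEnd_sum {ι : Type*} (s : Finset ι) (m : Fin n) (X : ι → Matrix (Fin n) (Fin n) R) :
    covEnd δ Γ m (∑ i ∈ s, X i) = ∑ i ∈ s, covEnd δ Γ m (X i) := by
  unfold covEnd
  rw [map_sum, Finset.mul_sum, Finset.sum_mul, Finset.sum_sub_distrib, Finset.sum_add_distrib]

/-- The Ricci identity for endomorphisms: second derivatives of `X` cancel by `hδ`, first
derivatives cancel by the product rule, and the commutator with the curvature remains. -/
theorem covEnd_comm (hδ : ∀ i j f, δ i (δ j f) = δ j (δ i f)) (k l : Fin n)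
    (X : Matrix (Fin n) (Fin n) R) :
    covEnd δ Γ k (covEnd δ Γ l X) - covEnd δ Γ l (covEnd δ Γ k X) =
      curvForm δ Γ k l * X - X * curvForm δ Γ k l := by
  unfold covEnd curvForm
  simp only [map_add, map_sub, matDeriv_mul, matDeriv_comm hδ l k]
  noncomm_ring

/-- Only the endomorphism indices are differentiated covariantly here, so this is `d_Γ F = 0`: it
rests on commuting derivations and the Jacobi identity and needs no symmetry of `Γ`. -/
theorem second_bianchi (hδ : ∀ i j f, δ i (δ j f) = δ j (δ i f)) (m k l : Fin n) :
    covEnd δ Γ m (curvForm δ Γ k l) + covEnd δ Γ k (curvForm δ Γ l m) +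
      covEnd δ Γ l (curvForm δ Γ m k) = 0 := by
  unfold covEnd curvForm
  simp only [map_add, map_sub, matDeriv_mul, matDeriv_comm hδ l k, matDeriv_comm hδ l m,
    matDeriv_comm hδ k m]
  noncomm_ring

section Metric

variable {G : Matrix (Fin n) (Fin n) R}

/-- This is the integrability condition of `hG`: differentiate it once more and antisymmetrise. -/
theorem curvForm_skew (hδ : ∀ i j f, δ i (δ j f) = δ j (δ i f))
    (hG : ∀ k, matDeriv (δ k) G = (Γ k).transpose * G + G * Γ k) (k l : Fin n) :
    G * curvForm δ Γ k l + (curvForm δ Γ k l).transpose * G = 0 := by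
  have h := matDeriv_comm hδ k l G
  rw [hG l, hG k] at h
  simp only [map_add, matDeriv_mul, matDeriv_transpose, hG] at h
  rw [← sub_eq_zero] at h
  rw [← h]
  unfold curvForm
  simp only [Matrix.transpose_add, Matrix.transpose_sub, Matrix.transpose_mul]
  noncomm_ring

/-- A covariantly constant bilinear relation is preserved by covariant differentiation. -/
theorem covEnd_skew
    (hG : ∀ k, matDeriv (δ k) G = (Γ k).transpose * G + G * Γ k) {X : Matrix (Fin n) (Fin n) R}
    {c : R} (hX : G * X + X.transpose * G = c • G) (m : Fin n) :
    G * covEnd δ Γ m X + (covEnd δ Γ m X).transpose * G = δ m c • G := by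
  have h := congrArg (matDeriv (δ m)) hX
  simp only [map_add, matDeriv_mul, matDeriv_transpose, matDeriv_smul, hG, smul_add] at h
  -- The terms `c • ∂G` are rewritten through `hX`, so that they complete the derivatives of `X` to
  -- covariant ones.
  have h1 : c • ((Γ m).transpose * G) = (Γ m).transpose * (G * X + X.transpose * G) := by
    rw [hX, mul_smul_comm]
  have h2 : c • (G * Γ m) = (G * X + X.transpose * G) * Γ m := by
    rw [hX, smul_mul_assoc]
  rw [h1, h2] at h
  have h3 := eq_sub_of_add_eq h.symm
  rw [h3]
  unfold covEnd
  simp only [Matrix.transpose_add, Matrix.transpose_sub, Matrix.transpose_mul]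
  noncomm_ring

end Metric

end CurvatureAlgebra

/-! ### Schur's lemma. -/

section Schur

variable {R : Type*} [CommRing R] [Algebra ℝ R] {n : ℕ}
  {δ : Fin n → Derivation ℝ R R} {Γ : Fin n → Matrix (Fin n) (Fin n) R}

/-- The covariant derivative of the curvature, all of whose indices are differentiated. -/
def covCurv (δ : Fin n → Derivation ℝ R R) (Γ : Fin n → Matrix (Fin n) (Fin n) R)
    (m k l : Fin n) : Matrix (Fin n) (Fin n) R :=
  covEnd δ Γ m (curvForm δ Γ k l) - ∑ p, Γ m p k • curvForm δ Γ p l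
    - ∑ p, Γ m p l • curvForm δ Γ k p

theorem covCurv_swap (m k l : Fin n) : covCurv δ Γ m l k = - covCurv δ Γ m k l := by
  unfold covCurv
  rw [curvForm_swap k l, covEnd_neg]
  simp only [fun p => curvForm_swap (δ := δ) (Γ := Γ) p k,
    fun p => curvForm_swap (δ := δ) (Γ := Γ) l p, smul_neg, Finset.sum_neg_distrib]
  abel

/-- For symmetric `Γ` the corrections on the two form indices cancel in pairs against the
antisymmetry of the curvature, so `second_bianchi` survives for the full covariant derivative. -/
theorem covCurv_bianchi (hδ : ∀ i j f, δ i (δ j f) = δ j (δ i f))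
    (hΓ : ∀ k i j, Γ k i j = Γ j i k) (m k l : Fin n) :
    covCurv δ Γ m k l + covCurv δ Γ k l m + covCurv δ Γ l m k = 0 := by
  have h := second_bianchi hδ m k l (Γ := Γ)
  unfold covCurv
  have e1 : ∑ p, Γ k p m • curvForm δ Γ l p = - ∑ p, Γ m p k • curvForm δ Γ p l := by
    rw [← Finset.sum_neg_distrib]
    exact Finset.sum_congr rfl fun p _ => by rw [hΓ k p m, curvForm_swap p l, smul_neg]
  have e2 : ∑ p, Γ l p m • curvForm δ Γ p k = - ∑ p, Γ m p l • curvForm δ Γ k p := by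
    rw [← Finset.sum_neg_distrib]
    exact Finset.sum_congr rfl fun p _ => by rw [hΓ l p m, curvForm_swap k p, smul_neg]
  have e3 : ∑ p, Γ l p k • curvForm δ Γ m p = - ∑ p, Γ k p l • curvForm δ Γ p m := by
    rw [← Finset.sum_neg_distrib]
    exact Finset.sum_congr rfl fun p _ => by rw [hΓ l p k, curvForm_swap p m, smul_neg]
  rw [e1, e2, e3, ← h]
  abel

/-- The trace of an endomorphism derivative is not yet tensorial: the middle sum is not a Ricci
term. In `contract_covCurv` it cancels against the correction on the contracted form index. -/
theorem contract_covEnd_curvForm (m l j : Fin n) :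
    ∑ k, covEnd δ Γ m (curvForm δ Γ k l) k j = δ m (ricForm δ Γ j l)
      + ∑ k, ∑ p, Γ m k p * curvForm δ Γ k l p j - ∑ p, ricForm δ Γ p l * Γ m p j := by
  unfold covEnd ricForm
  simp only [Matrix.add_apply, Matrix.sub_apply, matDeriv_apply, Matrix.mul_apply,
    Finset.sum_add_distrib, Finset.sum_sub_distrib, map_sum, Finset.sum_mul]
  congr 1
  exact Finset.sum_comm

theorem contract_covCurv (m l j : Fin n) :
    ∑ k, covCurv δ Γ m k l k j = δ m (ricForm δ Γ j l)
      - ∑ p, ricForm δ Γ p l * Γ m p j - ∑ p, Γ m p l * ricForm δ Γ j p := by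
  unfold covCurv
  simp only [Matrix.sub_apply, Matrix.sum_apply, Matrix.smul_apply, smul_eq_mul,
    Finset.sum_sub_distrib, contract_covEnd_curvForm]
  have e1 : ∑ k, ∑ p, Γ m p k * curvForm δ Γ p l k j =
      ∑ k, ∑ p, Γ m k p * curvForm δ Γ k l p j := Finset.sum_comm
  have e2 : ∑ k, ∑ p, Γ m p l * curvForm δ Γ k p k j = ∑ p, Γ m p l * ricForm δ Γ j p := by
    rw [Finset.sum_comm]
    exact Finset.sum_congr rfl fun p _ => by rw [ricForm, Finset.mul_sum]
  rw [e1, e2]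
  ring

/-- The trace of `∇R` is `∇Ric`, and `∇(ρ g) = dρ ⊗ g` because the metric is parallel. -/
theorem contract_covCurv_einstein {G : Matrix (Fin n) (Fin n) R}
    (hG : ∀ k, matDeriv (δ k) G = (Γ k).transpose * G + G * Γ k) {ρ : R}
    (hρ : ∀ j k, ricForm δ Γ j k = ρ * G j k) (m l j : Fin n) :
    ∑ k, covCurv δ Γ m k l k j = δ m ρ * G j l := by
  have hg := congrFun (congrFun (hG m) j) l
  simp only [matDeriv_apply, Matrix.add_apply, Matrix.mul_apply, Matrix.transpose_apply] at hg
  rw [contract_covCurv]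
  simp only [hρ, Derivation.leibniz, smul_eq_mul, hg, mul_add, Finset.mul_sum]
  have e1 : ∑ p, ρ * G p l * Γ m p j = ∑ p, ρ * (Γ m p j * G p l) :=
    Finset.sum_congr rfl fun p _ => by ring
  have e2 : ∑ p, Γ m p l * (ρ * G j p) = ∑ p, ρ * (G j p * Γ m p l) :=
    Finset.sum_congr rfl fun p _ => by ring
  rw [e1, e2]
  ring

theorem covCurv_skew (hδ : ∀ i j f, δ i (δ j f) = δ j (δ i f)) {G : Matrix (Fin n) (Fin n) R}
    (hG : ∀ k, matDeriv (δ k) G = (Γ k).transpose * G + G * Γ k) (m k l : Fin n) :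
    G * covCurv δ Γ m k l + (covCurv δ Γ m k l).transpose * G = 0 := by
  have h0 := fun k l => curvForm_skew hδ hG k l
  have h1 := covEnd_skew hG (c := 0) ((h0 k l).trans (zero_smul R G).symm) m
  rw [map_zero, zero_smul] at h1
  unfold covCurv
  simp only [Matrix.transpose_sub, Matrix.transpose_sum, Matrix.transpose_smul, mul_sub, sub_mul,
    Finset.mul_sum, Finset.sum_mul, mul_smul_comm, smul_mul_assoc]
  have e (c : Fin n → R) (A : Fin n → Matrix (Fin n) (Fin n) R)
      (hA : ∀ p, G * A p + (A p).transpose * G = 0) :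
      ∑ p, c p • (G * A p) + ∑ p, c p • ((A p).transpose * G) = 0 := by
    rw [← Finset.sum_add_distrib]
    exact Finset.sum_eq_zero fun p _ => by rw [← smul_add, hA, smul_zero]
  have e1 := e (fun p => Γ m p k) (fun p => curvForm δ Γ p l) fun p => h0 p l
  have e2 := e (fun p => Γ m p l) (fun p => curvForm δ Γ k p) fun p => h0 k p
  have := congrArg₂ (· - ·) h1 (congrArg₂ (· + ·) e1 e2)
  simp only [add_zero, sub_zero] at this
  rw [← this]
  abel

/-- Raising an index of a `G`-skew endomorphism with `H = G⁻¹` gives an antisymmetric matrix. -/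
theorem mul_inv_skew {S : Type*} [CommRing S] {G H X : Matrix (Fin n) (Fin n) S} (hGH : G * H = 1) (hHG : H * G = 1)
    (hHt : H.transpose = H) (hX : G * X + X.transpose * G = 0) (i j : Fin n) :
    (X * H) i j = - (X * H) j i := by
  have h := congrArg (fun X => H * X * H) hX
  simp only [mul_add, add_mul, mul_zero, zero_mul] at h
  rw [← mul_assoc, hHG, one_mul, mul_assoc, mul_assoc, hGH, mul_one] at h
  have h2 := congrFun (congrFun h i) j
  rw [Matrix.add_apply, Matrix.zero_apply] at h2
  rw [eq_neg_of_add_eq_zero_left h2]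
  congr 1
  rw [← Matrix.transpose_apply (X * H), Matrix.transpose_mul, hHt]

/-- Both sides are full contractions of `T k l * H`, with its two matrix indices in opposite orders.
The lemma moves the inner trace from the index `k` to the index `l`, which turns a divergence of the
curvature into a trace that is already known. -/
theorem sum_contract_skew {S : Type*} [CommRing S] (T : Fin n → Fin n → Matrix (Fin n) (Fin n) S)
    (H : Matrix (Fin n) (Fin n) S) (hT : ∀ k l i j, (T k l * H) i j = - (T k l * H) j i) :
    ∑ l, ∑ j, (∑ k, T k l k j) * H j l = - ∑ k, ∑ j, (∑ l, T k l l j) * H j k := by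
  have h1 : ∑ l, ∑ j, (∑ k, T k l k j) * H j l = ∑ k, ∑ l, (T k l * H) k l := by
    simp only [Finset.sum_mul, Matrix.mul_apply]
    rw [Finset.sum_comm (f := fun k l => ∑ j, T k l k j * H j l)]
    exact Finset.sum_congr rfl fun l _ => Finset.sum_comm
  have h2 : ∑ k, ∑ j, (∑ l, T k l l j) * H j k = ∑ k, ∑ l, (T k l * H) l k := by
    simp only [Finset.sum_mul, Matrix.mul_apply]
    exact Finset.sum_congr rfl fun l _ => Finset.sum_comm
  rw [h1, h2]
  simp only [← Finset.sum_neg_distrib]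
  exact Finset.sum_congr rfl fun k _ => Finset.sum_congr rfl fun l _ => hT k l k l

/-- **Schur's lemma**: the factor of proportionality in an Einstein metric is constant. -/
theorem schur (hn : 2 < n) (hδ : ∀ i j f, δ i (δ j f) = δ j (δ i f))
    (hΓ : ∀ k i j, Γ k i j = Γ j i k) {G H : Matrix (Fin n) (Fin n) R}
    (hGH : G * H = 1) (hGt : G.transpose = G)
    (hG : ∀ k, matDeriv (δ k) G = (Γ k).transpose * G + G * Γ k) {ρ : R}
    (hρ : ∀ j k, ricForm δ Γ j k = ρ * G j k) (m : Fin n) : δ m ρ = 0 := by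
  have hHG : H * G = 1 := mul_eq_one_comm.mp hGH
  have hHt : H.transpose = H := by
    have h : H.transpose * G = 1 := by
      rw [← hGt, ← Matrix.transpose_mul, hGH, Matrix.transpose_one]
    calc H.transpose = H.transpose * (G * H) := by rw [hGH, mul_one]
      _ = H := by rw [← mul_assoc, h, one_mul]
  have hcon := contract_covCurv_einstein hG hρ
  have hskewH (m k l) := mul_inv_skew hGH hHG hHt (covCurv_skew hδ hG m k l)
  have hone (a b : Fin n) : ∑ j, G j a * H j b = if a = b then 1 else 0 := by
    have := congrFun (congrFun hGH a) b
    rw [Matrix.mul_apply, Matrix.one_apply] at this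
    rw [← this]
    refine Finset.sum_congr rfl fun j _ => ?_
    rw [← Matrix.transpose_apply G, hGt]
  have htr : ∑ l, ∑ j, G j l * H j l = (n : R) := by simp [hone]
  -- First trace of the Bianchi identity, over the upper index and `k`; the two outer terms are
  -- traces known from `hcon`, the middle one is a divergence.
  have hB (l j : Fin n) : δ m ρ * G j l + ∑ k, covCurv δ Γ k l m k j - δ l ρ * G j m = 0 := by
    have h : ∑ k, (covCurv δ Γ m k l + covCurv δ Γ k l m + covCurv δ Γ l m k) k j = 0 :=
      Finset.sum_eq_zero fun k _ => by rw [covCurv_bianchi hδ hΓ]; rfl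
    simp only [Matrix.add_apply, Finset.sum_add_distrib, covCurv_swap l _ m, Matrix.neg_apply,
      Finset.sum_neg_distrib, hcon] at h
    rw [← h]; ring
  -- Second trace, with `H`: skewness converts the divergence into another known trace, so it
  -- contributes `-δ m ρ`.
  have hmid : ∑ l, ∑ j, (∑ k, covCurv δ Γ k l m k j) * H j l = - δ m ρ := by
    rw [sum_contract_skew (fun k l => covCurv δ Γ k l m) H fun k l => hskewH k l m]
    simp only [hcon, mul_assoc, ← Finset.mul_sum, hone]
    simp
  have hfin : ∑ l, ∑ j, (δ m ρ * G j l + ∑ k, covCurv δ Γ k l m k j - δ l ρ * G j m) * H j l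
      = 0 := by simp [hB]
  have hthird : ∑ l, ∑ j, δ l ρ * G j m * H j l = δ m ρ := by
    simp [mul_assoc, ← Finset.mul_sum, hone]
  have hfirst : ∑ l, ∑ j, δ m ρ * G j l * H j l = δ m ρ * n := by
    simp only [mul_assoc, ← Finset.mul_sum, htr]
  simp only [sub_mul, add_mul, Finset.sum_sub_distrib, Finset.sum_add_distrib, hmid, hthird,
    hfirst] at hfin
  -- The three contributions are `n`, `-1` and `-1` times `δ m ρ`. The ring may have zero divisors,
  -- so `n - 2` is cancelled as an invertible real scalar.
  have hc : algebraMap ℝ R ((n : ℝ) - 2) * δ m ρ = 0 := by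
    rw [map_sub, map_natCast, map_ofNat, ← hfin]; ring
  have hne : ((n : ℝ) - 2) ≠ 0 := by
    have : (2 : ℝ) < n := by exact_mod_cast hn
    linarith
  calc δ m ρ = algebraMap ℝ R (((n : ℝ) - 2)⁻¹ * ((n : ℝ) - 2)) * δ m ρ := by
        rw [inv_mul_cancel₀ hne, map_one, one_mul]
    _ = 0 := by rw [map_mul, mul_assoc, hc, mul_zero]

end Schur

/-! ### Lie derivatives of connection, curvature and metric; concurrent and parallel fields. -/

section LieAlgebraic

variable {R : Type*} [CommRing R] [Algebra ℝ R] {n : ℕ}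
  {δ : Fin n → Derivation ℝ R R} {Γ : Fin n → Matrix (Fin n) (Fin n) R}

/-- The covariant differential `∇ⱼ Yⁱ` of a vector field. -/
def covField (δ : Fin n → Derivation ℝ R R) (Γ : Fin n → Matrix (Fin n) (Fin n) R)
    (Y : Fin n → R) : Matrix (Fin n) (Fin n) R :=
  Matrix.of (fun i j => δ j (Y i)) + ∑ l, Y l • Γ l

/-- The Lie derivative of a connection, in terms of derivations of a ring of functions. -/
def lieConn (δ : Fin n → Derivation ℝ R R) (Γ : Fin n → Matrix (Fin n) (Fin n) R)
    (Y : Fin n → R) (i j k : Fin n) : R :=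
  δ j (δ k (Y i)) + ∑ l, (Y l * δ l (Γ k i j) + Γ j i l * δ k (Y l) + Γ k i l * δ j (Y l)
    - Γ k l j * δ l (Y i))

/-- The Lie derivative of a bilinear form, in terms of derivations of a ring of functions. -/
def lieForm (δ : Fin n → Derivation ℝ R R) (G : Fin n → Fin n → R)
    (Y : Fin n → R) (i j : Fin n) : R :=
  ∑ k, (Y k * δ k (G i j) + G k j * δ i (Y k) + G i k * δ j (Y k))

/-- The terms `Y l • [Γ k, Γ l]` and `Y l • ∂ₖ Γ l` cancel against those in the curvature; what
remains is linear in `Γ` apart from the outer `covEnd`. -/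
theorem covEnd_covField_add (k : Fin n) (Y : Fin n → R) :
    covEnd δ Γ k (covField δ Γ Y) + ∑ l, Y l • curvForm δ Γ l k =
      covEnd δ Γ k (Matrix.of fun i j => δ j (Y i)) +
        ∑ l, (δ k (Y l) • Γ l + Y l • matDeriv (δ l) (Γ k)) := by
  rw [covField, covEnd_add, covEnd_sum, add_assoc, ← Finset.sum_add_distrib]
  congr 1
  refine Finset.sum_congr rfl fun l _ => ?_
  rw [covEnd_smul, add_assoc, ← smul_add]
  congr 2
  unfold covEnd curvForm
  abel

/-- The classical formula `L_Y Γⁱⱼₖ = ∇ₖ∇ⱼYⁱ + Rⁱⱼₗₖ Yˡ`. It makes the Lie derivative of the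
connection accessible to the matrix calculus. -/
theorem lieConn_eq (hδ : ∀ i j f, δ i (δ j f) = δ j (δ i f))
    (hΓ : ∀ k i j, Γ k i j = Γ j i k) (Y : Fin n → R) (i j k : Fin n) :
    lieConn δ Γ Y i j k =
      (covEnd δ Γ k (covField δ Γ Y) + ∑ l, Y l • curvForm δ Γ l k) i j := by
  rw [covEnd_covField_add]
  simp only [covEnd, Matrix.add_apply, Matrix.sub_apply, Matrix.sum_apply, Matrix.smul_apply,
    smul_eq_mul, matDeriv_apply, Matrix.mul_apply, Matrix.of_apply, lieConn,
    Finset.sum_add_distrib, Finset.sum_sub_distrib]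
  rw [hδ j k]
  have e1 : ∑ l, Γ j i l * δ k (Y l) = ∑ l, δ k (Y l) * Γ l i j :=
    Finset.sum_congr rfl fun l _ => by rw [hΓ j i l, mul_comm]
  have e2 : ∑ l, Γ k l j * δ l (Y i) = ∑ l, δ l (Y i) * Γ k l j :=
    Finset.sum_congr rfl fun l _ => mul_comm _ _
  rw [e1, e2]
  ring

theorem lieConn_swap (hδ : ∀ i j f, δ i (δ j f) = δ j (δ i f))
    (hΓ : ∀ k i j, Γ k i j = Γ j i k) (Y : Fin n → R) (i j k : Fin n) :
    lieConn δ Γ Y i j k = lieConn δ Γ Y i k j := by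
  unfold lieConn
  rw [hδ j k]
  congr 1
  refine Finset.sum_congr rfl fun l _ => ?_
  rw [hΓ k i j, hΓ k l j]
  ring

/-- The Lie derivative of the curvature vanishes along an affine vector field. -/
theorem curvForm_lie_of_affine (hδ : ∀ i j f, δ i (δ j f) = δ j (δ i f))
    (hΓ : ∀ k i j, Γ k i j = Γ j i k) {Y : Fin n → R}
    (hY : ∀ i j k, lieConn δ Γ Y i j k = 0) (m k : Fin n) :
    ∑ l, (δ m (Y l) • curvForm δ Γ k l - δ k (Y l) • curvForm δ Γ m l
      - Y l • covEnd δ Γ l (curvForm δ Γ m k)) =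
    curvForm δ Γ m k * covField δ Γ Y - covField δ Γ Y * curvForm δ Γ m k := by
  -- With `A = ∇Y`, the equation `L_Y Γ = 0` is the first-order system `∇ₖ A = Yˡ Rₖₗ`. Its
  -- integrability condition is the claim.
  have hA (k : Fin n) : covEnd δ Γ k (covField δ Γ Y) = ∑ l, Y l • curvForm δ Γ k l := by
    have h : covEnd δ Γ k (covField δ Γ Y) + ∑ l, Y l • curvForm δ Γ l k = 0 := by
      ext i j
      rw [← lieConn_eq hδ hΓ, hY]; rfl
    rw [eq_neg_of_add_eq_zero_left h, ← Finset.sum_neg_distrib]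
    exact Finset.sum_congr rfl fun l _ => by rw [curvForm_swap k l, smul_neg, neg_neg]
  rw [← covEnd_comm hδ, hA, hA, covEnd_sum, covEnd_sum, ← Finset.sum_sub_distrib]
  refine Finset.sum_congr rfl fun l _ => ?_
  -- The Bianchi identity trades the derivatives along `m` and `k` for the derivative of the
  -- curvature along `l`, that is, along `Y`.
  have hb := second_bianchi hδ m k l (Γ := Γ)
  rw [curvForm_swap m l, covEnd_neg] at hb
  rw [covEnd_smul, covEnd_smul, eq_neg_of_add_eq_zero_right hb]
  module

/-- Trace of `curvForm_lie_of_affine`: contraction commutes with the Lie derivative, and all terms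
in which `Γ` appears undifferentiated outside the curvature cancel between the two sides. -/
theorem ricForm_lie_of_affine (hδ : ∀ i j f, δ i (δ j f) = δ j (δ i f))
    (hΓ : ∀ k i j, Γ k i j = Γ j i k) {Y : Fin n → R}
    (hY : ∀ i j k, lieConn δ Γ Y i j k = 0) (j k : Fin n) :
    lieForm δ (ricForm δ Γ) Y j k = 0 := by
  have h : ∑ m, (∑ l, (δ m (Y l) • curvForm δ Γ k l - δ k (Y l) • curvForm δ Γ m l
      - Y l • covEnd δ Γ l (curvForm δ Γ m k))) m j =
      ∑ m, (curvForm δ Γ m k * covField δ Γ Y - covField δ Γ Y * curvForm δ Γ m k) m j :=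
    Finset.sum_congr rfl fun m _ => by rw [curvForm_lie_of_affine hδ hΓ hY]
  simp only [Matrix.sum_apply, Matrix.sub_apply, Matrix.smul_apply, smul_eq_mul,
    Finset.sum_sub_distrib, Matrix.mul_apply] at h
  have a1 : ∑ m, ∑ l, δ m (Y l) * curvForm δ Γ k l m j =
      - ∑ m, ∑ l, δ l (Y m) * curvForm δ Γ m k l j := by
    rw [Finset.sum_comm]
    simp only [← Finset.sum_neg_distrib]
    refine Finset.sum_congr rfl fun m _ => Finset.sum_congr rfl fun l _ => ?_
    rw [curvForm_swap m k]
    simp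
  have a2 : ∑ m, ∑ l, δ k (Y l) * curvForm δ Γ m l m j = ∑ l, δ k (Y l) * ricForm δ Γ j l := by
    rw [Finset.sum_comm]
    simp only [ricForm, Finset.mul_sum]
  have a3 : ∑ m, ∑ l, Y l * covEnd δ Γ l (curvForm δ Γ m k) m j =
      ∑ l, Y l * δ l (ricForm δ Γ j k)
      + ∑ l, ∑ m, ∑ p, Y l * (Γ l m p * curvForm δ Γ m k p j)
      - ∑ l, ∑ p, Y l * (ricForm δ Γ p k * Γ l p j) := by
    rw [Finset.sum_comm]
    simp only [← Finset.mul_sum, contract_covEnd_curvForm, mul_add, mul_sub,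
      Finset.sum_add_distrib, Finset.sum_sub_distrib]
  have a4 : ∑ m, ∑ p, curvForm δ Γ m k m p * covField δ Γ Y p j =
      ∑ p, ricForm δ Γ p k * δ j (Y p) + ∑ l, ∑ p, Y l * (ricForm δ Γ p k * Γ l p j) := by
    rw [Finset.sum_comm]
    simp only [← Finset.sum_mul]
    rw [Finset.sum_comm (f := fun l p => Y l * (ricForm δ Γ p k * Γ l p j)),
      ← Finset.sum_add_distrib]
    refine Finset.sum_congr rfl fun p _ => ?_
    simp only [covField, Matrix.add_apply, Matrix.sum_apply, Matrix.smul_apply, Matrix.of_apply,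
      smul_eq_mul, ricForm, mul_add, Finset.mul_sum]
    congr 1
    exact Finset.sum_congr rfl fun l _ => by ring
  have a5 : ∑ m, ∑ p, covField δ Γ Y m p * curvForm δ Γ m k p j =
      ∑ m, ∑ l, δ l (Y m) * curvForm δ Γ m k l j
      + ∑ l, ∑ m, ∑ p, Y l * (Γ l m p * curvForm δ Γ m k p j) := by
    rw [Finset.sum_comm (f := fun l m => ∑ p, Y l * (Γ l m p * curvForm δ Γ m k p j)),
      ← Finset.sum_add_distrib]
    refine Finset.sum_congr rfl fun m _ => ?_
    rw [Finset.sum_comm (f := fun l p => Y l * (Γ l m p * curvForm δ Γ m k p j)),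
      ← Finset.sum_add_distrib]
    refine Finset.sum_congr rfl fun p _ => ?_
    simp only [covField, Matrix.add_apply, Matrix.sum_apply, Matrix.smul_apply, Matrix.of_apply,
      smul_eq_mul, add_mul, Finset.sum_mul]
    congr 1
    exact Finset.sum_congr rfl fun l _ => by ring
  rw [a1, a2, a3, a4, a5] at h
  have a6 : ∑ l, ricForm δ Γ j l * δ k (Y l) = ∑ l, δ k (Y l) * ricForm δ Γ j l :=
    Finset.sum_congr rfl fun l _ => mul_comm _ _
  unfold lieForm
  rw [Finset.sum_add_distrib, Finset.sum_add_distrib, a6]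
  linear_combination -h

theorem lieForm_smul {ρ : R} (hρ : ∀ m, δ m ρ = 0) (G : Fin n → Fin n → R)
    (Y : Fin n → R) (i j : Fin n) :
    lieForm δ (fun a b => ρ * G a b) Y i j = ρ * lieForm δ G Y i j := by
  simp only [lieForm, Finset.mul_sum, Derivation.leibniz, hρ, smul_eq_mul]
  exact Finset.sum_congr rfl fun l _ => by ring

section Metric

variable {G H : Matrix (Fin n) (Fin n) R}

/-- Metric compatibility absorbs `Yˡ ∂ₗ G` into the connection part of `∇Y`, giving `L_Y g = ∇ᵢYⱼ +
∇ⱼYᵢ`. -/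
theorem lieForm_eq (hG : ∀ k, matDeriv (δ k) G = (Γ k).transpose * G + G * Γ k)
    (Y : Fin n → R) (i j : Fin n) :
    lieForm δ G Y i j = (G * covField δ Γ Y + (covField δ Γ Y).transpose * G) i j := by
  have h : G * covField δ Γ Y + (covField δ Γ Y).transpose * G =
      G * Matrix.of (fun i j => δ j (Y i)) + (Matrix.of (fun i j => δ j (Y i))).transpose * G
      + ∑ l, Y l • matDeriv (δ l) G := by
    simp only [covField, hG, mul_add, add_mul, Matrix.transpose_add, Matrix.transpose_sum,
      Matrix.transpose_smul, Finset.mul_sum, Finset.sum_mul, smul_add, Finset.sum_add_distrib,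
      mul_smul_comm, smul_mul_assoc]
    abel
  rw [h]
  simp only [lieForm, Matrix.add_apply, Matrix.sum_apply, Matrix.smul_apply, smul_eq_mul,
    matDeriv_apply, Matrix.mul_apply, Matrix.transpose_apply, Matrix.of_apply,
    Finset.sum_add_distrib]
  have e : ∑ l, G l j * δ i (Y l) = ∑ l, δ i (Y l) * G l j :=
    Finset.sum_congr rfl fun l _ => mul_comm _ _
  rw [e]
  ring

theorem two_cancel {x : R} (h : x = -x) : x = 0 := by
  have h2 : algebraMap ℝ R 2 * x = 0 := by
    rw [map_ofNat, two_mul]; nth_rewrite 1 [h]; simp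
  calc x = algebraMap ℝ R (2⁻¹ * 2) * x := by norm_num
    _ = 0 := by rw [map_mul, mul_assoc, h2, mul_zero]

/-- A homothetic vector field preserves the Levi-Civita connection. -/
theorem lieConn_eq_zero_of_homothetic (hδ : ∀ i j f, δ i (δ j f) = δ j (δ i f))
    (hΓ : ∀ k i j, Γ k i j = Γ j i k) (hHG : H * G = 1) (hGt : G.transpose = G)
    (hG : ∀ k, matDeriv (δ k) G = (Γ k).transpose * G + G * Γ k) {Y : Fin n → R} {c : R}
    (hc : ∀ k, δ k c = 0) (hY : ∀ i j, lieForm δ G Y i j = c * G i j) (i j k : Fin n) :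
    lieConn δ Γ Y i j k = 0 := by
  have hA : G * covField δ Γ Y + (covField δ Γ Y).transpose * G = c • G := by
    ext i j
    rw [← lieForm_eq hG, hY]; rfl
  -- By `lieConn_eq`, `W k` is `L_Y Γ` with one lower index fixed.
  set W : Fin n → Matrix (Fin n) (Fin n) R := fun k =>
    covEnd δ Γ k (covField δ Γ Y) + ∑ l, Y l • curvForm δ Γ l k with hW
  have hskew (k : Fin n) : G * W k + (W k).transpose * G = 0 := by
    have h1 := covEnd_skew hG hA k
    rw [hc, zero_smul] at h1
    have h2 : ∑ l, Y l • (G * curvForm δ Γ l k + (curvForm δ Γ l k).transpose * G) = 0 :=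
      Finset.sum_eq_zero fun l _ => by rw [curvForm_skew hδ hG, smul_zero]
    rw [hW]
    simp only [mul_add, add_mul, Matrix.transpose_add, Matrix.transpose_sum,
      Matrix.transpose_smul, Finset.mul_sum, Finset.sum_mul, mul_smul_comm, smul_mul_assoc]
    simp only [smul_add, Finset.sum_add_distrib] at h2
    have := congrArg₂ (· + ·) h1 h2
    simp only [add_zero] at this
    rw [← this]; abel
  have hsym (i j k : Fin n) : (G * W k) i j = (G * W j) i k := by
    simp only [Matrix.mul_apply, hW]
    refine Finset.sum_congr rfl fun l _ => ?_
    rw [← lieConn_eq hδ hΓ, ← lieConn_eq hδ hΓ, lieConn_swap hδ hΓ]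
  have hanti (k i j : Fin n) : (G * W k) i j = - (G * W k) j i := by
    have h := congrFun (congrFun (hskew k) i) j
    rw [Matrix.add_apply, Matrix.zero_apply] at h
    rw [eq_neg_of_add_eq_zero_left h, ← Matrix.transpose_apply (G * W k), Matrix.transpose_mul, hGt]
  -- As in the uniqueness of the Levi-Civita connection: a three-index object symmetric in one pair
  -- and antisymmetric in another equals its own negative after six alternating exchanges.
  have hzero : G * W k = 0 := by
    ext i j
    refine two_cancel ?_
    calc (G * W k) i j = - (G * W j) k i := by rw [hsym, hanti]
      _ = (G * W i) j k := by rw [hsym, hanti, neg_neg]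
      _ = - (G * W k) i j := by rw [hsym, hanti]
  rw [lieConn_eq hδ hΓ, show covEnd δ Γ k (covField δ Γ Y) + ∑ l, Y l • curvForm δ Γ l k = W k
    from rfl, ← one_mul (W k), ← hHG, mul_assoc, hzero, mul_zero]
  rfl

end Metric

/-- The covariant derivative of a vector field given by its components. -/
def covVec (δ : Fin n → Derivation ℝ R R) (Γ : Fin n → Matrix (Fin n) (Fin n) R)
    (k : Fin n) (Z : Fin n → R) (i : Fin n) : R :=
  δ k (Z i) + ∑ j, Γ k i j * Z j

theorem covVec_comm (hδ : ∀ i j f, δ i (δ j f) = δ j (δ i f)) (k l : Fin n) (Z : Fin n → R)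
    (i : Fin n) :
    covVec δ Γ k (covVec δ Γ l Z) i - covVec δ Γ l (covVec δ Γ k Z) i =
      ∑ j, curvForm δ Γ k l i j * Z j := by
  have e (a b : Fin n) : ∑ j, (Γ a * Γ b) i j * Z j = ∑ j, Γ a i j * ∑ p, Γ b j p * Z p := by
    simp only [Matrix.mul_apply, Finset.sum_mul, Finset.mul_sum, mul_assoc]
    exact Finset.sum_comm
  simp only [covVec, map_add, map_sum, Derivation.leibniz, smul_eq_mul, mul_add,
    Finset.sum_add_distrib, curvForm, Matrix.add_apply, Matrix.sub_apply, matDeriv_apply, sub_mul,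
    add_mul, Finset.sum_sub_distrib, e, hδ l k]
  have e2 (a b : Fin n) : ∑ j, Z j * δ a (Γ b i j) = ∑ j, δ a (Γ b i j) * Z j :=
    Finset.sum_congr rfl fun l _ => mul_comm _ _
  rw [e2, e2]
  ring

/-- A vector field whose covariant differential is a constant multiple of the identity is
annihilated by the Ricci tensor. -/
theorem ricForm_mul_concurrent (hδ : ∀ i j f, δ i (δ j f) = δ j (δ i f))
    (hΓ : ∀ k i j, Γ k i j = Γ j i k) {Z : Fin n → R} {c : R} (hc : ∀ k, δ k c = 0)
    (hZ : ∀ k i, covVec δ Γ k Z i = if i = k then c else 0) (l : Fin n) :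
    ∑ j, ricForm δ Γ j l * Z j = 0 := by
  -- Since `∇ₗ Z = c eₗ` with `c` constant, one more derivative gives `c Γ k eₗ`, which is symmetric
  -- in `k` and `l`; hence the curvature annihilates `Z`.
  have h (k l : Fin n) (i : Fin n) : covVec δ Γ k (covVec δ Γ l Z) i = Γ k i l * c := by
    have : covVec δ Γ l Z = fun i => if i = l then c else 0 := funext (hZ l)
    rw [this]
    simp only [covVec]
    split_ifs <;> simp [hc]
  have hF (k : Fin n) : ∑ j, curvForm δ Γ k l k j * Z j = 0 := by
    rw [← covVec_comm hδ, h, h, hΓ l k k, sub_self]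
  simp only [ricForm, Finset.sum_mul]
  rw [Finset.sum_comm]
  exact Finset.sum_eq_zero fun k _ => hF k

section Metric

variable {G H : Matrix (Fin n) (Fin n) R}

/-- Lowering an index commutes with covariant differentiation: `∂ₖ Zⱼ - Γⁱⱼₖ Zᵢ = gⱼᵢ ∇ₖ Zⁱ`. -/
theorem deriv_lower (hG : ∀ k, matDeriv (δ k) G = (Γ k).transpose * G + G * Γ k)
    (Z : Fin n → R) (k j : Fin n) :
    δ k (∑ l, G j l * Z l) =
      ∑ i, Γ k i j * (∑ l, G i l * Z l) + ∑ i, G j i * covVec δ Γ k Z i := by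
  have hg (l : Fin n) := congrFun (congrFun (hG k) j) l
  simp only [matDeriv_apply, Matrix.add_apply, Matrix.mul_apply, Matrix.transpose_apply] at hg
  simp only [map_sum, Derivation.leibniz, smul_eq_mul, hg, covVec, mul_add, Finset.mul_sum,
    Finset.sum_add_distrib]
  have e1 : ∑ l, ∑ p, Z l * (Γ k p j * G p l) = ∑ p, ∑ l, Γ k p j * (G p l * Z l) := by
    rw [Finset.sum_comm]
    exact Finset.sum_congr rfl fun p _ => Finset.sum_congr rfl fun l _ => by ring
  have e2 : ∑ l, ∑ p, Z l * (G j p * Γ k p l) = ∑ p, ∑ l, G j p * (Γ k p l * Z l) := by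
    rw [Finset.sum_comm]
    exact Finset.sum_congr rfl fun p _ => Finset.sum_congr rfl fun l _ => by ring
  rw [e1, e2]
  ring

theorem eq_zero_of_lower {S : Type*} [CommRing S] {G H : Matrix (Fin n) (Fin n) S}
    (hHG : H * G = 1) {Z : Fin n → S} (h : ∀ j, ∑ i, G j i * Z i = 0) : Z = 0 := by
  have h' : G.mulVec Z = 0 := funext h
  rw [← Matrix.one_mulVec Z, ← hHG, ← Matrix.mulVec_mulVec, h', Matrix.mulVec_zero]

/-- Here `Z` is the gradient of `f`, and by `deriv_lower` its lowered covariant differential is the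
Hessian of `f`. -/
theorem covVec_eq_zero_of_hessian (hHG : H * G = 1)
    (hG : ∀ k, matDeriv (δ k) G = (Γ k).transpose * G + G * Γ k) {f : R} {Z : Fin n → R}
    (hZ : ∀ i, ∑ l, G i l * Z l = δ i f)
    (hf : ∀ j k, δ k (δ j f) - ∑ i, Γ k i j * δ i f = 0) (k i : Fin n) :
    covVec δ Γ k Z i = 0 := by
  refine congrFun (eq_zero_of_lower (Z := covVec δ Γ k Z) hHG fun j => ?_) i
  have h := deriv_lower hG Z k j
  simp only [hZ] at h
  rw [← hf j k, h]; ring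

/-- For a gradient, `G * ∇Y` is a Hessian and so symmetric; the Killing equation makes it skew.
Hence it vanishes, and `G` is invertible. -/
theorem covVec_eq_zero_of_gradient_killing (hδ : ∀ i j f, δ i (δ j f) = δ j (δ i f))
    (hΓ : ∀ k i j, Γ k i j = Γ j i k) (hHG : H * G = 1) (hGt : G.transpose = G)
    (hG : ∀ k, matDeriv (δ k) G = (Γ k).transpose * G + G * Γ k) {f : R} {Y : Fin n → R}
    (hf : ∀ i, ∑ l, G i l * Y l = δ i f) (hY : ∀ i j, lieForm δ G Y i j = 0) (k i : Fin n) :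
    covVec δ Γ k Y i = 0 := by
  have hA (i k : Fin n) : covField δ Γ Y i k = covVec δ Γ k Y i := by
    simp only [covField, covVec, Matrix.add_apply, Matrix.sum_apply, Matrix.smul_apply,
      Matrix.of_apply, smul_eq_mul]
    congr 1
    exact Finset.sum_congr rfl fun l _ => by rw [hΓ k i l, mul_comm]
  have hGA (j k : Fin n) :
      (G * covField δ Γ Y) j k = δ k (δ j f) - ∑ i, Γ k i j * δ i f := by
    have h := deriv_lower hG Y k j
    simp only [hf] at h
    rw [h, Matrix.mul_apply]
    simp only [hA]
    ring
  have hsym (j k : Fin n) : (G * covField δ Γ Y) j k = (G * covField δ Γ Y) k j := by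
    rw [hGA, hGA, hδ]
    congr 1
    exact Finset.sum_congr rfl fun i _ => by rw [hΓ k i j]
  have hzero (j k : Fin n) : (G * covField δ Γ Y) j k = 0 := by
    have h := (lieForm_eq hG Y j k).symm.trans (hY j k)
    rw [Matrix.add_apply] at h
    have ht : ((covField δ Γ Y).transpose * G) j k = (G * covField δ Γ Y) k j := by
      rw [← Matrix.transpose_apply (G * covField δ Γ Y), Matrix.transpose_mul, hGt]
    rw [ht, hsym k j] at h
    exact two_cancel (eq_neg_of_add_eq_zero_left h)
  refine congrFun (eq_zero_of_lower (Z := covVec δ Γ k Y) hHG fun j => ?_) i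
  rw [← hzero j k, Matrix.mul_apply]
  simp only [hA]

end Metric

end LieAlgebraic

/-! ### The ring of smooth functions on an open set of the coordinate space and its derivations. -/

section SmoothFunctions

variable {n : ℕ}

theorem contDiffOn_pd {U : Set (Coord n)} (hU : IsOpen U) {f : Coord n → ℝ}
    (hf : ContDiffOn ℝ ∞ f U) (k : Fin n) : ContDiffOn ℝ ∞ (pd k f) U :=
  (hf.fderiv_of_isOpen hU (m := ∞) (by simp)).clm_apply contDiffOn_const

/-- Partial derivatives depend on germs only; this makes `pdDer` independent of the arbitrary
extension chosen by `smoothExt`. -/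
theorem pd_congr {U : Set (Coord n)} (hU : IsOpen U) {f g : Coord n → ℝ}
    (h : ∀ y ∈ U, f y = g y) {y : Coord n} (hy : y ∈ U) (k : Fin n) : pd k f y = pd k g y := by
  have : f =ᶠ[nhds y] g := by
    filter_upwards [hU.mem_nhds hy] with z hz using h z hz
  rw [pd, pd, this.fderiv_eq]

theorem differentiableAt_of_contDiffOn {U : Set (Coord n)} (hU : IsOpen U) {f : Coord n → ℝ}
    (hf : ContDiffOn ℝ ∞ f U) {y : Coord n} (hy : y ∈ U) : DifferentiableAt ℝ f y :=
  (hf.contDiffAt (hU.mem_nhds hy)).differentiableAt (by simp)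

theorem pd_comm {U : Set (Coord n)} (hU : IsOpen U) {f : Coord n → ℝ}
    (hf : ContDiffOn ℝ ∞ f U) {y : Coord n} (hy : y ∈ U) (k l : Fin n) :
    pd k (pd l f) y = pd l (pd k f) y := by
  have hc : ContDiffAt ℝ ∞ f y := hf.contDiffAt (hU.mem_nhds hy)
  have hs : IsSymmSndFDerivAt ℝ f y := hc.isSymmSndFDerivAt
    (by rw [minSmoothness_of_isRCLikeNormedField]; exact WithTop.coe_le_coe.2 le_top)
  have hd : DifferentiableAt ℝ (fderiv ℝ f) y :=
    ((hf.fderiv_of_isOpen hU (m := ∞) (by simp)).contDiffAt (hU.mem_nhds hy)).differentiableAt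
      (by simp)
  have e (a b : Fin n) : pd a (pd b f) y =
      fderiv ℝ (fderiv ℝ f) y (EuclideanSpace.single a 1) (EuclideanSpace.single b 1) := by
    unfold pd
    rw [fderiv_clm_apply hd (differentiableAt_const _)]
    simp
  rw [e, e, hs.eq]

/-- The subalgebra of smooth functions on an open subset of the coordinate space. -/
def smoothSubalgebra (U : TopologicalSpace.Opens (Coord n)) : Subalgebra ℝ (U → ℝ) where
  carrier := {f | ∃ F : Coord n → ℝ, ContDiffOn ℝ ∞ F U ∧ ∀ y : U, F y = f y}
  mul_mem' := by
    rintro f g ⟨F, hF, hf⟩ ⟨K, hK, hg⟩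
    exact ⟨fun y => F y * K y, hF.mul hK, fun y => by simp [hf, hg]⟩
  add_mem' := by
    rintro f g ⟨F, hF, hf⟩ ⟨K, hK, hg⟩
    exact ⟨fun y => F y + K y, hF.add hK, fun y => by simp [hf, hg]⟩
  algebraMap_mem' r := ⟨fun _ => r, contDiffOn_const, fun y => rfl⟩

variable {U : TopologicalSpace.Opens (Coord n)}

/-- The ring of smooth functions on an open subset of the coordinate space. -/
def SmoothFun (U : TopologicalSpace.Opens (Coord n)) : Type := smoothSubalgebra U

instance : CommRing (SmoothFun U) := inferInstanceAs (CommRing (smoothSubalgebra U))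

instance : Algebra ℝ (SmoothFun U) := inferInstanceAs (Algebra ℝ (smoothSubalgebra U))

/-- The element of the ring of smooth functions given by a function smooth on `U`. -/
def smoothMk (f : Coord n → ℝ) (hf : ContDiffOn ℝ ∞ f U) : SmoothFun U :=
  Subtype.mk (p := (· ∈ smoothSubalgebra U)) (fun y => f y) ⟨f, hf, fun _ => rfl⟩

/-- An extension of a smooth function on `U` to the whole coordinate space. -/
noncomputable def smoothExt (f : SmoothFun U) : Coord n → ℝ := f.2.choose

theorem smoothExt_contDiffOn (f : SmoothFun U) : ContDiffOn ℝ ∞ (smoothExt f) U :=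
  f.2.choose_spec.1

theorem smoothExt_apply (f : SmoothFun U) {y : Coord n} (hy : y ∈ U) :
    (smoothExt f) y = f.1 ⟨y, hy⟩ := f.2.choose_spec.2 ⟨y, hy⟩

theorem smoothMk_eq_iff {f g : Coord n → ℝ} {hf : ContDiffOn ℝ ∞ f U} {hg : ContDiffOn ℝ ∞ g U} :
    smoothMk f hf = smoothMk g hg ↔ ∀ y ∈ U, f y = g y := by
  refine ⟨fun h y hy => ?_, fun h => Subtype.ext (funext fun y => h y y.2)⟩
  exact congrFun (congrArg Subtype.val h) ⟨y, hy⟩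

/-- The partial derivative as a derivation of the ring of smooth functions. -/
noncomputable def pdDer (U : TopologicalSpace.Opens (Coord n)) (k : Fin n) :
    Derivation ℝ (SmoothFun U) (SmoothFun U) :=
  Derivation.mk'
    { toFun := fun f => smoothMk (pd k (smoothExt f)) (contDiffOn_pd U.2 (smoothExt_contDiffOn f) k)
      map_add' := fun f g => by
        refine Subtype.ext (funext fun y => ?_)
        have h := pd_congr U.2 (f := smoothExt (f + g)) (g := (smoothExt f) + (smoothExt g)) (fun z hz => by
          simp only [Pi.add_apply, smoothExt_apply _ hz]; rfl) y.2 k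
        change pd k (smoothExt (f + g)) y = pd k (smoothExt f) y + pd k (smoothExt g) y
        rw [h, pd, fderiv_add (differentiableAt_of_contDiffOn U.2 (smoothExt_contDiffOn f) y.2)
          (differentiableAt_of_contDiffOn U.2 (smoothExt_contDiffOn g) y.2)]
        rfl
      map_smul' := fun r f => by
        refine Subtype.ext (funext fun y => ?_)
        have h := pd_congr U.2 (f := smoothExt (r • f)) (g := r • (smoothExt f)) (fun z hz => by
          simp only [Pi.smul_apply, smoothExt_apply _ hz]; rfl) y.2 k
        change pd k (smoothExt (r • f)) y = r * pd k (smoothExt f) y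
        rw [h, pd, fderiv_const_smul (differentiableAt_of_contDiffOn U.2 (smoothExt_contDiffOn f) y.2)]
        rfl }
    fun f g => by
      refine Subtype.ext (funext fun y => ?_)
      have h := pd_congr U.2 (f := smoothExt (f * g)) (g := (smoothExt f) * (smoothExt g)) (fun z hz => by
        simp only [Pi.mul_apply, smoothExt_apply _ hz]; rfl) y.2 k
      change pd k (smoothExt (f * g)) y = f.1 y * pd k (smoothExt g) y + g.1 y * pd k (smoothExt f) y
      rw [h, pd, fderiv_mul (differentiableAt_of_contDiffOn U.2 (smoothExt_contDiffOn f) y.2)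
        (differentiableAt_of_contDiffOn U.2 (smoothExt_contDiffOn g) y.2),
        smoothExt_apply _ y.2, smoothExt_apply _ y.2]
      rfl

theorem pdDer_smoothMk {f : Coord n → ℝ} (hf : ContDiffOn ℝ ∞ f U) (k : Fin n) :
    pdDer U k (smoothMk f hf) = smoothMk (pd k f) (contDiffOn_pd U.2 hf k) := by
  refine Subtype.ext (funext fun y => ?_)
  exact pd_congr U.2 (fun z hz => (smoothExt_apply _ hz)) y.2 k

theorem smoothMk_ext' (f : SmoothFun U) : smoothMk (smoothExt f) (smoothExt_contDiffOn f) = f :=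
  Subtype.ext (funext fun y => smoothExt_apply f y.2)

theorem pdDer_comm (k l : Fin n) (f : SmoothFun U) :
    pdDer U k (pdDer U l f) = pdDer U l (pdDer U k f) := by
  rw [← smoothMk_ext' f, pdDer_smoothMk, pdDer_smoothMk, pdDer_smoothMk, pdDer_smoothMk,
    smoothMk_eq_iff]
  exact fun y hy => pd_comm U.2 (smoothExt_contDiffOn f) hy k l

/-- Evaluation of smooth functions at a point. -/
def smoothEval (y : U) : SmoothFun U →+* ℝ :=
  (Pi.evalRingHom (fun _ : U => ℝ) y).comp (smoothSubalgebra U).val.toRingHom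

theorem smoothEval_smoothMk {f : Coord n → ℝ} (hf : ContDiffOn ℝ ∞ f U) (y : U) :
    smoothEval y (smoothMk f hf) = f y := rfl

theorem smoothFun_ext {f g : SmoothFun U} (h : ∀ y : U, smoothEval y f = smoothEval y g) :
    f = g := Subtype.ext (funext h)

theorem smoothEval_pdDer_smoothMk {f : Coord n → ℝ} (hf : ContDiffOn ℝ ∞ f U) (k : Fin n)
    (y : U) : smoothEval y (pdDer U k (smoothMk f hf)) = pd k f y := by
  rw [pdDer_smoothMk]; rfl

end SmoothFunctions

/-! ### Einstein metrics on an open set of the coordinate space. -/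

section LocalGeometry

variable {n : ℕ} {U : TopologicalSpace.Opens (Coord n)} {G : Coord n → Matrix (Fin n) (Fin n) ℝ}

/-- A smooth field of invertible symmetric matrices on an open set. -/
structure IsMetricOn (G : Coord n → Matrix (Fin n) (Fin n) ℝ)
    (U : TopologicalSpace.Opens (Coord n)) : Prop where
  smooth : ∀ i j, ContDiffOn ℝ ∞ (fun y => G y i j) U
  symm : ∀ y i j, G y i j = G y j i
  det : ∀ y ∈ U, (G y).det ≠ 0

/-- The Einstein condition with nowhere vanishing scalar curvature, on an open set. -/
def IsEinsteinOn (G : Coord n → Matrix (Fin n) (Fin n) ℝ)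
    (U : TopologicalSpace.Opens (Coord n)) : Prop :=
  ∀ y ∈ U, (∀ j k, ricci G j k y = scalarCurvature G y / n * G y j k) ∧ scalarCurvature G y ≠ 0

theorem contDiffOn_det {s : Set (Coord n)} {A : Coord n → Matrix (Fin n) (Fin n) ℝ}
    (hA : ∀ i j, ContDiffOn ℝ ∞ (fun y => A y i j) s) :
    ContDiffOn ℝ ∞ (fun y => (A y).det) s := by
  simp only [Matrix.det_apply']
  exact ContDiffOn.sum fun σ _ => contDiffOn_const.mul (contDiffOn_prod fun i _ => hA _ _)

/-- Cramer's rule: the entry is a quotient of determinants, which are polynomials in the entries of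
`G`. -/
theorem IsMetricOn.inv_smooth (hG : IsMetricOn G U) (i j : Fin n) :
    ContDiffOn ℝ ∞ (fun y => (G y)⁻¹ i j) U := by
  have h : ∀ y, (G y)⁻¹ i j = ((G y).det)⁻¹ * ((G y).updateRow j (Pi.single i 1)).det := by
    intro y
    rw [Matrix.inv_def, Matrix.smul_apply, Matrix.adjugate_apply, Ring.inverse_eq_inv', smul_eq_mul]
  simp only [h]
  refine ((contDiffOn_det hG.smooth).inv fun y hy => hG.det y hy).mul (contDiffOn_det ?_)
  intro a b
  by_cases hab : a = j
  · subst hab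
    simp only [Matrix.updateRow_self]
    exact contDiffOn_const
  · simp only [Matrix.updateRow_ne hab]
    exact hG.smooth a b

theorem IsMetricOn.christoffel_smooth (hG : IsMetricOn G U) (i j k : Fin n) :
    ContDiffOn ℝ ∞ (christoffel G i j k) U :=
  contDiffOn_const.mul (ContDiffOn.sum fun l _ => (hG.inv_smooth i l).mul
    (((contDiffOn_pd U.2 (hG.smooth l k) j).add (contDiffOn_pd U.2 (hG.smooth l j) k)).sub
      (contDiffOn_pd U.2 (hG.smooth j k) l)))

theorem IsMetricOn.mul_inv (hG : IsMetricOn G U) {y : Coord n} (hy : y ∈ U) :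
    G y * (G y)⁻¹ = 1 := Matrix.mul_nonsing_inv _ (isUnit_iff_ne_zero.2 (hG.det y hy))

theorem IsMetricOn.christoffel_symm (hG : IsMetricOn G U) (i j k : Fin n) (y : Coord n) :
    christoffel G i j k y = christoffel G i k j y := by
  unfold christoffel
  congr 1
  refine Finset.sum_congr rfl fun l _ => ?_
  have : (fun z => G z j k) = fun z => G z k j := funext fun z => hG.symm z j k
  rw [this]
  ring

theorem IsMetricOn.lower_christoffel (hG : IsMetricOn G U) {y : Coord n} (hy : y ∈ U)
    (m j k : Fin n) :
    ∑ i, G y m i * christoffel G i j k y =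
      (1 / 2) * (pd j (fun z => G z m k) y + pd k (fun z => G z m j) y
        - pd m (fun z => G z j k) y) := by
  set c : Fin n → ℝ := fun l => pd j (fun z => G z l k) y + pd k (fun z => G z l j) y
        - pd l (fun z => G z j k) y with hc
  have h : (G y).mulVec ((G y)⁻¹.mulVec c) = c := by
    rw [Matrix.mulVec_mulVec, hG.mul_inv hy, Matrix.one_mulVec]
  have h2 := congrFun h m
  simp only [Matrix.mulVec, dotProduct] at h2
  change _ = 1 / 2 * c m
  rw [← h2, Finset.mul_sum]
  refine Finset.sum_congr rfl fun i _ => ?_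
  simp only [christoffel, hc]
  ring

/-- The Levi-Civita connection is metric: two Christoffel symbols of the first kind add up to the
derivative, the other four terms cancelling. -/
theorem IsMetricOn.pd_metric (hG : IsMetricOn G U) {y : Coord n} (hy : y ∈ U) (i j k : Fin n) :
    pd k (fun z => G z i j) y =
      ∑ l, christoffel G l i k y * G y l j + ∑ l, G y i l * christoffel G l j k y := by
  have e : ∑ l, christoffel G l i k y * G y l j = ∑ l, G y j l * christoffel G l i k y :=
    Finset.sum_congr rfl fun l _ => by rw [mul_comm, hG.symm y l j]
  have s (a b : Fin n) : (fun z => G z a b) = fun z => G z b a := funext fun z => hG.symm z a b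
  rw [e, hG.lower_christoffel hy, hG.lower_christoffel hy, s j i, s j k, s i k]
  ring

/-- The metric as a matrix of smooth functions. -/
def IsMetricOn.mat (hG : IsMetricOn G U) : Matrix (Fin n) (Fin n) (SmoothFun U) :=
  Matrix.of fun i j => smoothMk (fun y => G y i j) (hG.smooth i j)

/-- The inverse metric as a matrix of smooth functions. -/
noncomputable def IsMetricOn.invMat (hG : IsMetricOn G U) : Matrix (Fin n) (Fin n) (SmoothFun U) :=
  Matrix.of fun i j => smoothMk (fun y => (G y)⁻¹ i j) (hG.inv_smooth i j)

/-- The Levi-Civita connection as matrices of smooth functions. -/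
noncomputable def IsMetricOn.conn (hG : IsMetricOn G U) (k : Fin n) : Matrix (Fin n) (Fin n) (SmoothFun U) :=
  Matrix.of fun i j => smoothMk (christoffel G i j k) (hG.christoffel_smooth i j k)

theorem IsMetricOn.mat_mul_invMat (hG : IsMetricOn G U) : hG.mat * hG.invMat = 1 := by
  ext i j : 2
  refine smoothFun_ext fun y => ?_
  have h := congrFun (congrFun (hG.mul_inv y.2) i) j
  rw [Matrix.mul_apply, Matrix.one_apply] at h
  rw [Matrix.mul_apply, Matrix.one_apply, map_sum]
  simp only [IsMetricOn.mat, IsMetricOn.invMat, Matrix.of_apply, map_mul, smoothEval_smoothMk]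
  rw [h]
  split_ifs <;> simp

theorem IsMetricOn.invMat_mul_mat (hG : IsMetricOn G U) : hG.invMat * hG.mat = 1 :=
  mul_eq_one_comm.mp hG.mat_mul_invMat

theorem IsMetricOn.mat_transpose (hG : IsMetricOn G U) : hG.mat.transpose = hG.mat := by
  ext i j : 2
  exact smoothFun_ext fun y => hG.symm y j i

theorem IsMetricOn.conn_symm (hG : IsMetricOn G U) (k i j : Fin n) :
    hG.conn k i j = hG.conn j i k :=
  smoothFun_ext fun y => hG.christoffel_symm i j k y

theorem IsMetricOn.matDeriv_mat (hG : IsMetricOn G U) (k : Fin n) :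
    matDeriv (pdDer U k) hG.mat = (hG.conn k).transpose * hG.mat + hG.mat * hG.conn k := by
  ext i j : 2
  refine smoothFun_ext fun y => ?_
  simp only [matDeriv_apply, Matrix.add_apply, Matrix.mul_apply, map_add, map_sum, map_mul,
    Matrix.transpose_apply, IsMetricOn.mat, IsMetricOn.conn, Matrix.of_apply,
    smoothEval_pdDer_smoothMk, smoothEval_smoothMk]
  exact hG.pd_metric y.2 i j k

/-- In the quadratic terms the matrix products carry the lower indices of the first Christoffel
symbol in the opposite order; otherwise the two definitions agree term by term. -/
theorem IsMetricOn.eval_ricForm (hG : IsMetricOn G U) (j k : Fin n) (y : U) :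
    smoothEval y (ricForm (pdDer U) hG.conn j k) = ricci G j k y := by
  simp only [ricForm, curvForm, matDeriv_apply, Matrix.add_apply, Matrix.sub_apply,
    Matrix.mul_apply, map_add, map_sub, map_sum, map_mul, IsMetricOn.conn, Matrix.of_apply,
    smoothEval_pdDer_smoothMk, smoothEval_smoothMk, ricci]
  refine Finset.sum_congr rfl fun i _ => ?_
  rw [Finset.sum_sub_distrib, add_sub_assoc]
  congr 1
  congr 1
  · refine Finset.sum_congr rfl fun l _ => ?_
    rw [hG.christoffel_symm i l i]
  · refine Finset.sum_congr rfl fun l _ => ?_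
    rw [hG.christoffel_symm i l k]

/-- The components of a smooth vector field as smooth functions. -/
def fieldMk (X : Coord n → Coord n) (hX : ∀ i, ContDiffOn ℝ ∞ (fun y => X y i) U) (i : Fin n) :
    SmoothFun U := smoothMk (fun y => X y i) (hX i)

theorem IsMetricOn.eval_lieConn (hG : IsMetricOn G U) {X : Coord n → Coord n}
    (hX : ∀ i, ContDiffOn ℝ ∞ (fun y => X y i) U) (i j k : Fin n) (y : U) :
    smoothEval y (lieConn (pdDer U) hG.conn (fieldMk X hX) i j k) =
      lieDerivConnection G X i j k y := by
  simp only [lieConn, fieldMk, IsMetricOn.conn, Matrix.of_apply, pdDer_smoothMk, map_add, map_sub,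
    map_sum, map_mul, smoothEval_smoothMk, lieDerivConnection]

theorem IsMetricOn.eval_lieForm (hG : IsMetricOn G U) {X : Coord n → Coord n}
    (hX : ∀ i, ContDiffOn ℝ ∞ (fun y => X y i) U) (i j : Fin n) (y : U) :
    smoothEval y (lieForm (pdDer U) hG.mat (fieldMk X hX) i j) = lieDerivMetric G X i j y := by
  simp only [lieForm, fieldMk, IsMetricOn.mat, Matrix.of_apply, pdDer_smoothMk, map_add,
    map_sum, map_mul, smoothEval_smoothMk, lieDerivMetric]

/-- The Einstein factor `R / n` as a smooth function. -/
noncomputable def IsMetricOn.factor (hG : IsMetricOn G U) : SmoothFun U :=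
  algebraMap ℝ _ ((n : ℝ)⁻¹) * ∑ j, ∑ k, hG.invMat j k * ricForm (pdDer U) hG.conn j k

theorem IsMetricOn.eval_factor (hG : IsMetricOn G U) (y : U) :
    smoothEval y hG.factor = scalarCurvature G y / n := by
  have : smoothEval y (algebraMap ℝ (SmoothFun U) ((n : ℝ)⁻¹)) = (n : ℝ)⁻¹ := rfl
  simp only [IsMetricOn.factor, map_mul, map_sum, hG.eval_ricForm, this, IsMetricOn.invMat,
    Matrix.of_apply, smoothEval_smoothMk, scalarCurvature]
  rw [div_eq_inv_mul]

theorem IsMetricOn.ricForm_eq (hG : IsMetricOn G U) (hE : IsEinsteinOn G U) (j k : Fin n) :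
    ricForm (pdDer U) hG.conn j k = hG.factor * hG.mat j k :=
  smoothFun_ext fun y => by
    rw [hG.eval_ricForm, map_mul, hG.eval_factor, (hE y y.2).1]; rfl

theorem IsMetricOn.factor_ne_zero (hn : 2 < n) (hG : IsMetricOn G U) (hE : IsEinsteinOn G U)
    (y : U) : smoothEval y hG.factor ≠ 0 := by
  rw [hG.eval_factor]
  exact div_ne_zero (hE y y.2).2 (by positivity)

theorem IsMetricOn.pdDer_factor (hn : 2 < n) (hG : IsMetricOn G U) (hE : IsEinsteinOn G U)
    (m : Fin n) : pdDer U m hG.factor = 0 :=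
  schur hn pdDer_comm hG.conn_symm hG.mat_mul_invMat hG.mat_transpose hG.matDeriv_mat
    (hG.ricForm_eq hE) m

/-- In a proper Einstein space every affine collineation is Killing. -/
theorem killing_of_affine (hn : 2 < n) (hG : IsMetricOn G U) (hE : IsEinsteinOn G U)
    {X : Coord n → Coord n} (hX : ∀ i, ContDiffOn ℝ ∞ (fun y => X y i) U)
    (h : ∀ y ∈ U, ∀ i j k, lieDerivConnection G X i j k y = 0) {y : Coord n} (hy : y ∈ U)
    (i j : Fin n) : lieDerivMetric G X i j y = 0 := by
  have h1 : lieForm (pdDer U) (ricForm (pdDer U) hG.conn) (fieldMk X hX) i j = 0 :=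
    ricForm_lie_of_affine pdDer_comm hG.conn_symm
      (fun i j k => smoothFun_ext fun y => by rw [hG.eval_lieConn, h y y.2, map_zero]) i j
  have h2 : ricForm (pdDer U) hG.conn = fun a b => hG.factor * hG.mat a b :=
    funext fun a => funext fun b => hG.ricForm_eq hE a b
  rw [h2] at h1
  -- The Lie derivative of the Ricci tensor vanishes. Its Einstein factor has zero derivatives by
  -- Schur's lemma and can be pulled out; it is cancelled only after evaluation, in the field `ℝ`.
  have h3 := congrArg (smoothEval ⟨y, hy⟩)
    ((lieForm_smul (hG.pdDer_factor hn hE) hG.mat (fieldMk X hX) i j).symm.trans h1)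
  rw [map_mul, hG.eval_lieForm, map_zero] at h3
  exact (mul_eq_zero.mp h3).resolve_left (hG.factor_ne_zero hn hE _)

/-- Homothetic vector fields are affine collineations. -/
theorem affine_of_homothetic (hG : IsMetricOn G U)
    {X : Coord n → Coord n} (hX : ∀ i, ContDiffOn ℝ ∞ (fun y => X y i) U) {c : ℝ}
    (h : ∀ y ∈ U, ∀ i j, lieDerivMetric G X i j y = c * G y i j) {y : Coord n} (hy : y ∈ U)
    (i j k : Fin n) : lieDerivConnection G X i j k y = 0 := by
  have h1 := lieConn_eq_zero_of_homothetic (Y := fieldMk X hX) (c := algebraMap ℝ _ c)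
    pdDer_comm hG.conn_symm hG.invMat_mul_mat hG.mat_transpose hG.matDeriv_mat
    (fun k => Derivation.map_algebraMap _ _)
    (fun i j => smoothFun_ext fun y => by rw [hG.eval_lieForm, h y y.2, map_mul]; rfl) i j k
  have h2 := congrArg (smoothEval ⟨y, hy⟩) h1
  rwa [hG.eval_lieConn, map_zero] at h2

/-- In a proper Einstein space a vector field with covariant differential a constant multiple of
the identity vanishes. -/
theorem eq_zero_of_covVec (hn : 2 < n) (hG : IsMetricOn G U) (hE : IsEinsteinOn G U)
    {Z : Fin n → SmoothFun U} {c : SmoothFun U} (hc : ∀ k, pdDer U k c = 0)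
    (hZ : ∀ k i, covVec (pdDer U) hG.conn k Z i = if i = k then c else 0) : Z = 0 := by
  refine eq_zero_of_lower hG.invMat_mul_mat fun l => smoothFun_ext fun y => ?_
  -- `Ric(Z, ·)` is the Einstein factor times the lowered `Z`, so the lowered `Z` vanishes.
  have h1 := congrArg (smoothEval y) (ricForm_mul_concurrent pdDer_comm hG.conn_symm hc hZ l)
  simp only [hG.ricForm_eq hE, mul_assoc, ← Finset.mul_sum] at h1
  rw [map_mul, map_zero] at h1
  rw [map_zero, ← (mul_eq_zero.mp h1).resolve_left (hG.factor_ne_zero hn hE _)]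
  congr 1
  refine Finset.sum_congr rfl fun j _ => ?_
  rw [← Matrix.transpose_apply hG.mat, hG.mat_transpose]

/-- The gradient of `f` is parallel, and `eq_zero_of_covVec` with `c = 0` excludes nonzero parallel
fields. -/
theorem pd_eq_zero_of_covHessian (hn : 2 < n) (hG : IsMetricOn G U) (hE : IsEinsteinOn G U)
    {f : Coord n → ℝ} (hf : ContDiffOn ℝ ∞ f U)
    (h : ∀ y ∈ U, ∀ j k, covHessian G f j k y = 0) {y : Coord n} (hy : y ∈ U) (i : Fin n) :
    pd i f y = 0 := by
  set Z : Fin n → SmoothFun U := fun l => ∑ i, hG.invMat l i * pdDer U i (smoothMk f hf) with hZ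
  have hlow (i : Fin n) : ∑ l, hG.mat i l * Z l = pdDer U i (smoothMk f hf) := by
    have := congrFun (congrArg (fun A => Matrix.mulVec A fun i => pdDer U i (smoothMk f hf))
      hG.mat_mul_invMat) i
    simp only [← Matrix.mulVec_mulVec, Matrix.one_mulVec] at this
    exact this
  have h0 : Z = 0 := eq_zero_of_covVec hn hG hE (c := 0) (fun k => map_zero _) fun k i => by
    rw [ite_self]
    refine covVec_eq_zero_of_hessian hG.invMat_mul_mat hG.matDeriv_mat hlow
      (fun j k => smoothFun_ext fun y => ?_) k i
    have h2 := h y y.2 j k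
    rw [covHessian, pd_comm U.2 hf y.2] at h2
    simpa only [IsMetricOn.conn, Matrix.of_apply, pdDer_smoothMk, map_sub, map_zero,
        map_sum, map_mul, smoothEval_smoothMk] using h2
  have h1 := hlow i
  rw [h0] at h1
  have h2 := congrArg (smoothEval ⟨y, hy⟩) h1
  rw [smoothEval_pdDer_smoothMk] at h2
  rw [← h2]
  simp

theorem eq_zero_of_gradient_killing (hn : 2 < n) (hG : IsMetricOn G U) (hE : IsEinsteinOn G U)
    {X : Coord n → Coord n} (hX : ∀ i, ContDiffOn ℝ ∞ (fun y => X y i) U)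
    {f : Coord n → ℝ} (hf : ContDiffOn ℝ ∞ f U)
    (hgrad : ∀ y ∈ U, ∀ i, ∑ j, G y i j * X y j = pd i f y)
    (h : ∀ y ∈ U, ∀ i j, lieDerivMetric G X i j y = 0) {y : Coord n} (hy : y ∈ U) (i : Fin n) :
    X y i = 0 := by
  have h0 := eq_zero_of_covVec hn hG hE (c := 0) (Z := fieldMk X hX) (fun k => map_zero _)
    fun k i => by
      rw [ite_self]
      refine covVec_eq_zero_of_gradient_killing pdDer_comm hG.conn_symm hG.invMat_mul_mat
        hG.mat_transpose hG.matDeriv_mat (f := smoothMk f hf)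
        (fun i => smoothFun_ext fun y => ?_) (fun i j => smoothFun_ext fun y => ?_) k i
      · rw [smoothEval_pdDer_smoothMk, ← hgrad y y.2, map_sum]; rfl
      · rw [hG.eval_lieForm, h y y.2, map_zero]
  exact congrArg (smoothEval ⟨y, hy⟩) (congrFun h0 i)

end LocalGeometry

/-! ### Calculus of directional derivatives. -/

section DirectionalDerivative

variable {E : Type*} [NormedAddCommGroup E] [NormedSpace ℝ E]

/-- `f` is differentiable at `p` and its derivative in the direction `u` is `d`. -/
structure HasDir (f : E → ℝ) (p u : E) (d : ℝ) : Prop where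
  diff : DifferentiableAt ℝ f p
  eq : fderiv ℝ f p u = d

variable {f g : E → ℝ} {p u : E} {a b : ℝ}

theorem HasDir.add (hf : HasDir f p u a) (hg : HasDir g p u b) :
    HasDir (fun z => f z + g z) p u (a + b) :=
  ⟨hf.diff.add hg.diff, by rw [fderiv_fun_add hf.diff hg.diff]; simp [hf.eq, hg.eq]⟩

theorem HasDir.sub (hf : HasDir f p u a) (hg : HasDir g p u b) :
    HasDir (fun z => f z - g z) p u (a - b) :=
  ⟨hf.diff.sub hg.diff, by rw [fderiv_fun_sub hf.diff hg.diff]; simp [hf.eq, hg.eq]⟩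

theorem HasDir.neg (hf : HasDir f p u a) : HasDir (fun z => - f z) p u (-a) :=
  ⟨hf.diff.neg, by rw [fderiv_fun_neg]; simp [hf.eq]⟩

theorem HasDir.mul (hf : HasDir f p u a) (hg : HasDir g p u b) :
    HasDir (fun z => f z * g z) p u (f p * b + g p * a) :=
  ⟨hf.diff.mul hg.diff, by rw [fderiv_fun_mul hf.diff hg.diff]; simp [hf.eq, hg.eq]⟩

theorem HasDir.sum {ι : Type*} {s : Finset ι} {f : ι → E → ℝ} {a : ι → ℝ}
    (h : ∀ i ∈ s, HasDir (f i) p u (a i)) :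
    HasDir (fun z => ∑ i ∈ s, f i z) p u (∑ i ∈ s, a i) := by
  refine ⟨DifferentiableAt.fun_sum fun i hi => (h i hi).diff, ?_⟩
  rw [fderiv_fun_sum fun i hi => (h i hi).diff, sum_apply]
  exact Finset.sum_congr rfl fun i hi => (h i hi).eq

theorem HasDir.clm (L : E →L[ℝ] ℝ) : HasDir L p u (L u) :=
  ⟨L.differentiableAt, by rw [L.fderiv]⟩

theorem HasDir.comp_clm {F : Type*} [NormedAddCommGroup F] [NormedSpace ℝ F] (L : E →L[ℝ] F)
    {h : F → ℝ} (hh : DifferentiableAt ℝ h (L p)) :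
    HasDir (fun z => h (L z)) p u (fderiv ℝ h (L p) (L u)) := by
  have : HasFDerivAt (fun z => h (L z)) _ p := hh.hasFDerivAt.comp p L.hasFDerivAt
  exact ⟨this.differentiableAt, by rw [this.fderiv]; rfl⟩

theorem HasDir.congr (hf : HasDir f p u a) (h : g =ᶠ[nhds p] f) : HasDir g p u a :=
  ⟨hf.diff.congr_of_eventuallyEq h, by rw [h.fderiv_eq, hf.eq]⟩

theorem clm_fderiv {F : Type*} [NormedAddCommGroup F] [NormedSpace ℝ F] (L : F →L[ℝ] ℝ)
    {h : E → F} (hh : DifferentiableAt ℝ h p) :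
    L (fderiv ℝ h p u) = fderiv ℝ (fun z => L (h z)) p u := by
  have : HasFDerivAt (fun z => L (h z)) _ p := L.hasFDerivAt.comp p hh.hasFDerivAt
  rw [this.fderiv]
  rfl

end DirectionalDerivative

/-! ### Functions of the parameter and the coordinates; total derivatives. -/

section TimeDependent

variable {n : ℕ}

/-- The partial derivative in the parameter. -/
noncomputable def dt (f : ℝ × Coord n → ℝ) (q : ℝ × Coord n) : ℝ := fderiv ℝ f q (1, 0)

/-- The partial derivative in a space coordinate. -/
noncomputable def dx (k : Fin n) (f : ℝ × Coord n → ℝ) (q : ℝ × Coord n) : ℝ :=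
  fderiv ℝ f q (0, EuclideanSpace.single k 1)

variable {S : Set (ℝ × Coord n)} {f : ℝ × Coord n → ℝ}

theorem contDiffOn_dir (hS : IsOpen S) (hf : ContDiffOn ℝ ∞ f S) (u : ℝ × Coord n) :
    ContDiffOn ℝ ∞ (fun q => fderiv ℝ f q u) S :=
  (hf.fderiv_of_isOpen hS (m := ∞) (by simp)).clm_apply contDiffOn_const

theorem contDiffOn_dt (hS : IsOpen S) (hf : ContDiffOn ℝ ∞ f S) : ContDiffOn ℝ ∞ (dt f) S :=
  contDiffOn_dir hS hf _

theorem contDiffOn_dx (hS : IsOpen S) (hf : ContDiffOn ℝ ∞ f S) (k : Fin n) :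
    ContDiffOn ℝ ∞ (dx k f) S := contDiffOn_dir hS hf _

theorem diffAt (hS : IsOpen S) (hf : ContDiffOn ℝ ∞ f S) {q : ℝ × Coord n} (hq : q ∈ S) :
    DifferentiableAt ℝ f q := (hf.contDiffAt (hS.mem_nhds hq)).differentiableAt (by simp)

theorem dir_comm (hS : IsOpen S) (hf : ContDiffOn ℝ ∞ f S) {q : ℝ × Coord n} (hq : q ∈ S)
    (u w : ℝ × Coord n) :
    fderiv ℝ (fun z => fderiv ℝ f z u) q w = fderiv ℝ (fun z => fderiv ℝ f z w) q u := by
  have hc : ContDiffAt ℝ ∞ f q := hf.contDiffAt (hS.mem_nhds hq)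
  have hs : IsSymmSndFDerivAt ℝ f q := hc.isSymmSndFDerivAt
    (by rw [minSmoothness_of_isRCLikeNormedField]; exact WithTop.coe_le_coe.2 le_top)
  have hd : DifferentiableAt ℝ (fderiv ℝ f) q :=
    ((hf.fderiv_of_isOpen hS (m := ∞) (by simp)).contDiffAt (hS.mem_nhds hq)).differentiableAt
      (by simp)
  have e (a b : ℝ × Coord n) : fderiv ℝ (fun z => fderiv ℝ f z a) q b =
      fderiv ℝ (fderiv ℝ f) q b a := by
    rw [fderiv_clm_apply hd (differentiableAt_const _)]
    simp
  rw [e, e, hs.eq]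

theorem dir_eq_zero_of_eq_zero (hS : IsOpen S) (h : ∀ q ∈ S, f q = 0) {q : ℝ × Coord n}
    (hq : q ∈ S) (u : ℝ × Coord n) : fderiv ℝ f q u = 0 := by
  have : f =ᶠ[nhds q] fun _ => 0 := by
    filter_upwards [hS.mem_nhds hq] with z hz using h z hz
  rw [this.fderiv_eq]; simp

/-- Commutation of the parameter derivative with a vanishing space derivative. -/
theorem dx_dt_eq_zero (hS : IsOpen S) (hf : ContDiffOn ℝ ∞ f S) {k : Fin n}
    (h : ∀ q ∈ S, dx k f q = 0) {q : ℝ × Coord n} (hq : q ∈ S) : dx k (dt f) q = 0 := by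
  unfold dx dt
  rw [dir_comm hS hf hq]
  exact dir_eq_zero_of_eq_zero hS h hq _

theorem pd_slice {t : ℝ} {y : Coord n} (hf : DifferentiableAt ℝ f (t, y)) (k : Fin n) :
    pd k (fun z => f (t, z)) y = dx k f (t, y) := by
  have h1 : HasFDerivAt (fun z : Coord n => (t, z)) (ContinuousLinearMap.inr ℝ ℝ (Coord n)) y :=
    hasFDerivAt_prodMk_right t y
  have := hf.hasFDerivAt.comp y h1
  unfold pd dx
  rw [show (fun z => f (t, z)) = f ∘ fun z => (t, z) from rfl, this.fderiv]
  simp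

theorem pd_pd_slice {J : Set ℝ} {U : Set (Coord n)} (hJ : IsOpen J) (hU : IsOpen U)
    (hf : ContDiffOn ℝ ∞ f (J ×ˢ U)) {t : ℝ} (ht : t ∈ J) {y : Coord n} (hy : y ∈ U)
    (j k : Fin n) : pd j (pd k fun z => f (t, z)) y = dx j (dx k f) (t, y) := by
  rw [pd_congr hU (g := fun z => dx k f (t, z))
    (fun z hz => pd_slice (diffAt (hJ.prod hU) hf ⟨ht, hz⟩) k) hy]
  exact pd_slice (diffAt (hJ.prod hU) (contDiffOn_dx (hJ.prod hU) hf k) ⟨ht, hy⟩) j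

theorem fderiv_split (f : ℝ × Coord n → ℝ) (q : ℝ × Coord n) (a : ℝ) (b : Coord n) :
    fderiv ℝ f q (a, b) = a * dt f q + ∑ k, b k * dx k f q := by
  have hb : b = ∑ k, b k • EuclideanSpace.single k (1 : ℝ) := by
    ext i
    simp [Finset.sum_apply, Pi.single_apply]
  have h : ((a, b) : ℝ × Coord n) =
      a • ((1 : ℝ), (0 : Coord n)) + ∑ k, b k • ((0 : ℝ), EuclideanSpace.single k (1 : ℝ)) := by
    refine Prod.ext ?_ ?_
    · simp [Prod.fst_sum]
    · rw [Prod.snd_add, Prod.snd_sum]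
      simpa using hb
  rw [h, map_add, map_sum, map_smul, smul_eq_mul]
  exact congrArg _ (Finset.sum_congr rfl fun k _ => by rw [map_smul]; rfl)

theorem totalDeriv_eq (f : ℝ × Coord n → ℝ) (p : ℝ × Coord n × Coord n) :
    totalDeriv f p = dt f (p.1, p.2.1) + ∑ k, p.2.2 k * dx k f (p.1, p.2.1) := by
  rw [totalDeriv, fderiv_split, one_mul]

/-- Forgetting the velocity, as a linear map. -/
def forgetVel (n : ℕ) : ℝ × Coord n × Coord n →L[ℝ] ℝ × Coord n :=
  (ContinuousLinearMap.fst ℝ ℝ (Coord n × Coord n)).prod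
    ((ContinuousLinearMap.fst ℝ (Coord n) (Coord n)).comp
      (ContinuousLinearMap.snd ℝ ℝ (Coord n × Coord n)))

/-- The velocity components as linear functionals. -/
noncomputable def velCoord (k : Fin n) : ℝ × Coord n × Coord n →L[ℝ] ℝ :=
  (EuclideanSpace.proj k).comp ((ContinuousLinearMap.snd ℝ (Coord n) (Coord n)).comp
      (ContinuousLinearMap.snd ℝ ℝ (Coord n × Coord n)))

theorem hasDir_base {p u : ℝ × Coord n × Coord n} (hf : DifferentiableAt ℝ f (p.1, p.2.1)) :
    HasDir (fun z : ℝ × Coord n × Coord n => f (z.1, z.2.1)) p u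
      (u.1 * dt f (p.1, p.2.1) + ∑ k, u.2.1 k * dx k f (p.1, p.2.1)) := by
  rw [← fderiv_split]
  exact HasDir.comp_clm (forgetVel n) hf

theorem hasDir_vel {p u : ℝ × Coord n × Coord n} (k : Fin n) :
    HasDir (fun z : ℝ × Coord n × Coord n => z.2.2 k) p u (u.2.2 k) :=
  HasDir.clm (velCoord k)

theorem hasDir_totalDeriv {p u : ℝ × Coord n × Coord n} (hS : IsOpen S) (hf : ContDiffOn ℝ ∞ f S)
    (hp : (p.1, p.2.1) ∈ S) :
    HasDir (totalDeriv f) p u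
      ((u.1 * dt (dt f) (p.1, p.2.1) + ∑ k, u.2.1 k * dx k (dt f) (p.1, p.2.1)) +
        ∑ k, (p.2.2 k * (u.1 * dt (dx k f) (p.1, p.2.1)
            + ∑ j, u.2.1 j * dx j (dx k f) (p.1, p.2.1)) +
          dx k f (p.1, p.2.1) * u.2.2 k)) := by
  rw [show totalDeriv f = _ from funext fun p => totalDeriv_eq f p]
  exact (hasDir_base (diffAt hS (contDiffOn_dt hS hf) hp)).add (HasDir.sum fun k _ =>
    (hasDir_vel k).mul (hasDir_base (diffAt hS (contDiffOn_dx hS hf k) hp)))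

end TimeDependent

/-! ### The bracket with the geodesic operator as a cubic polynomial in the velocity. -/

section DeterminingEquations

variable {n : ℕ}

theorem clm_eq_sum (L : Coord n →L[ℝ] ℝ) (w : Coord n) :
    L w = ∑ k, w k * L (EuclideanSpace.single k 1) := by
  have hw : w = ∑ k, w k • EuclideanSpace.single k (1 : ℝ) := by
    ext i
    simp [Finset.sum_apply, Pi.single_apply]
  conv_lhs => rw [hw]
  rw [map_sum]
  exact Finset.sum_congr rfl fun k _ => by rw [map_smul, smul_eq_mul]

theorem fderiv_eq_sum_pd (f : Coord n → ℝ) (y w : Coord n) :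
    fderiv ℝ f y w = ∑ l, w l * pd l f y := clm_eq_sum _ w

/-- The left-hand side of the determining equations of a point symmetry, as a polynomial in the
velocity. -/
noncomputable def determining (G : Coord n → Matrix (Fin n) (Fin n) ℝ) (ξ : ℝ × Coord n → ℝ)
    (η : ℝ × Coord n → Coord n) (t : ℝ) (y v : Coord n) (i : Fin n) : ℝ :=
  - dt (dt fun q => η q i) (t, y)
  + (dt (dt ξ) (t, y) * v i - 2 * ∑ k, v k * (dx k (dt fun q => η q i) (t, y)
      + ∑ j, christoffel G i j k y * dt (fun q => η q j) (t, y)))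
  + (2 * (∑ k, v k * dx k (dt ξ) (t, y)) * v i
      - ∑ j, ∑ k, v j * v k * lieDerivConnection G (fun z => η (t, z)) i j k y)
  + (∑ j, ∑ k, v j * v k * covHessian G (fun z => ξ (t, z)) j k y) * v i

/-- Collecting the terms of the bracket in powers of the velocity. -/
theorem collect_quadratic (Γ : Fin n → Fin n → ℝ) (hΓ : ∀ j k, Γ j k = Γ k j)
    (D : Fin n → Fin n → ℝ) (v τ φ : Fin n → ℝ) (c : ℝ) (hφ : ∀ j, φ j = τ j - c * v j) :
    ∑ j, ∑ k, (Γ j k * v j * φ k + v k * (Γ j k * φ j + v j * D j k)) =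
      2 * (∑ j, ∑ k, Γ j k * v j * τ k) - 2 * c * (∑ j, ∑ k, Γ j k * v j * v k)
        + ∑ j, ∑ k, v j * v k * D j k := by
  have s1 : ∑ j, ∑ k, Γ j k * v j * φ k =
      ∑ j, ∑ k, Γ j k * v j * τ k - c * ∑ j, ∑ k, Γ j k * v j * v k := by
    simp only [Finset.mul_sum, ← Finset.sum_sub_distrib]
    refine Finset.sum_congr rfl fun j _ => Finset.sum_congr rfl fun k _ => ?_
    rw [hφ]; ring
  have s2 : ∑ j, ∑ k, v k * (Γ j k * φ j) = ∑ j, ∑ k, Γ j k * v j * φ k := by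
    rw [Finset.sum_comm]
    refine Finset.sum_congr rfl fun j _ => Finset.sum_congr rfl fun k _ => ?_
    rw [hΓ k j]; ring
  have s3 : ∑ j, ∑ k, v k * (v j * D j k) = ∑ j, ∑ k, v j * v k * D j k :=
    Finset.sum_congr rfl fun j _ => Finset.sum_congr rfl fun k _ => by ring
  simp only [mul_add, Finset.sum_add_distrib]
  rw [s2, s1, s3]
  ring

/-- Contraction of the Lie derivative of a connection with `vʲ vᵏ`: the two terms `Γ ∂η` become
equal by symmetry, whence the factor 2. `D` stands for the derivative of `Γ` along the field `e`. -/
theorem sum_lieDeriv (Γ : Fin n → Fin n → Fin n → ℝ) (hΓ : ∀ i j k, Γ i j k = Γ i k j)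
    (D B : Fin n → Fin n → ℝ) (v e : Fin n → ℝ) (d : Fin n → Fin n → Fin n → ℝ)
    (hD : ∀ j k, D j k = ∑ l, e l * d l j k) (b : Fin n → Fin n → ℝ) (i : Fin n) :
    ∑ j, ∑ k, v j * v k * (B j k + ∑ l, (e l * d l j k + Γ i l j * b l k + Γ i l k * b l j
      - Γ l j k * b i l)) =
    ∑ j, ∑ k, v j * v k * B j k + ∑ j, ∑ k, v j * v k * D j k
      + 2 * (∑ j, ∑ k, Γ i j k * v j * ∑ l, v l * b k l)
      - ∑ l, b i l * ∑ j, ∑ k, Γ l j k * v j * v k := by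
  have s1 : ∑ j, ∑ k, v j * v k * ∑ l, Γ i l j * b l k =
      ∑ j, ∑ k, Γ i j k * v j * ∑ l, v l * b k l := by
    refine Finset.sum_congr rfl fun j _ => ?_
    simp only [Finset.mul_sum]
    rw [Finset.sum_comm]
    refine Finset.sum_congr rfl fun l _ => Finset.sum_congr rfl fun k _ => ?_
    rw [hΓ i j l]; ring
  have s2 : ∑ j, ∑ k, v j * v k * ∑ l, Γ i l k * b l j =
      ∑ j, ∑ k, v j * v k * ∑ l, Γ i l j * b l k := by
    rw [Finset.sum_comm]
    refine Finset.sum_congr rfl fun j _ => Finset.sum_congr rfl fun k _ => by ring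
  have s3 : ∑ j, ∑ k, v j * v k * ∑ l, Γ l j k * b i l =
      ∑ l, b i l * ∑ j, ∑ k, Γ l j k * v j * v k := by
    simp only [Finset.mul_sum]
    rw [Finset.sum_comm (s := Finset.univ) (t := Finset.univ)
      (f := fun l j => ∑ k, b i l * (Γ l j k * v j * v k))]
    refine Finset.sum_congr rfl fun j _ => ?_
    rw [Finset.sum_comm]
    refine Finset.sum_congr rfl fun l _ => Finset.sum_congr rfl fun k _ => by ring
  simp only [mul_add, Finset.sum_add_distrib, Finset.sum_sub_distrib, mul_sub, ← hD]
  rw [s3, s2, s1]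
  ring

variable {J : Set ℝ} {U : TopologicalSpace.Opens (Coord n)}
  {G : Coord n → Matrix (Fin n) (Fin n) ℝ} {ξ : ℝ × Coord n → ℝ} {η : ℝ × Coord n → Coord n}

theorem hasDir_geodesicRHS (hG : IsMetricOn G U) {p u : ℝ × Coord n × Coord n}
    (hy : p.2.1 ∈ U) (i : Fin n) :
    HasDir (fun z : ℝ × Coord n × Coord n => geodesicRHS G z.2.1 z.2.2 i) p u
      (- ∑ j, ∑ k, (christoffel G i j k p.2.1 * p.2.2 j * u.2.2 k + p.2.2 k *
        (christoffel G i j k p.2.1 * u.2.2 j +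
          p.2.2 j * ∑ l, u.2.1 l * pd l (christoffel G i j k) p.2.1))) := by
  refine HasDir.neg (HasDir.sum fun j _ => HasDir.sum fun k _ => ?_)
  refine (HasDir.mul ?_ (hasDir_vel j)).mul (hasDir_vel k)
  rw [← fderiv_eq_sum_pd]
  exact HasDir.comp_clm ((ContinuousLinearMap.fst ℝ (Coord n) (Coord n)).comp
      (ContinuousLinearMap.snd ℝ ℝ (Coord n × Coord n)))
      (differentiableAt_of_contDiffOn U.2 (hG.christoffel_smooth i j k) hy)

theorem totalDeriv_apply {q : ℝ × Coord n × Coord n} (hη : DifferentiableAt ℝ η (q.1, q.2.1))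
    (i : Fin n) : totalDeriv η q i = totalDeriv (fun z => η z i) q :=
  clm_fderiv (EuclideanSpace.proj i : Coord n →L[ℝ] ℝ) hη

theorem differentiableAt_geodesicOperator (hG : IsMetricOn G U) {p : ℝ × Coord n × Coord n}
    (hy : p.2.1 ∈ U) : DifferentiableAt ℝ (geodesicOperator G) p := by
  refine (differentiableAt_const _).prodMk (DifferentiableAt.prodMk ?_ ?_)
  · exact differentiableAt_snd.snd
  · exact differentiableAt_euclidean.2 fun i => (hasDir_geodesicRHS (u := 0) hG hy i).diff

theorem hasDir_prolongation (hJ : IsOpen J) (hξ : ContDiffOn ℝ ∞ ξ (J ×ˢ (U : Set (Coord n))))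
    (hη : ∀ i, ContDiffOn ℝ ∞ (fun q => η q i) (J ×ˢ (U : Set (Coord n))))
    {p u : ℝ × Coord n × Coord n} (hp : (p.1, p.2.1) ∈ J ×ˢ (U : Set (Coord n))) (i : Fin n) :
    HasDir (fun z => (totalDeriv η z - totalDeriv ξ z • z.2.2) i) p u
      (fderiv ℝ (totalDeriv fun q => η q i) p u -
        (totalDeriv ξ p * u.2.2 i + p.2.2 i * fderiv ℝ (totalDeriv ξ) p u)) := by
  have hS : IsOpen (J ×ˢ (U : Set (Coord n))) := hJ.prod U.2
  refine HasDir.congr (f := fun z => totalDeriv (fun q => η q i) z - totalDeriv ξ z * z.2.2 i)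
    (HasDir.sub ?_ (HasDir.mul ?_ (hasDir_vel i))) ?_
  · exact ⟨(hasDir_totalDeriv (u := 0) hS (hη i) hp).diff, rfl⟩
  · exact ⟨(hasDir_totalDeriv (u := 0) hS hξ hp).diff, rfl⟩
  · have hc : Continuous fun z : ℝ × Coord n × Coord n => (z.1, z.2.1) :=
      (forgetVel n).continuous
    filter_upwards [hc.continuousAt.preimage_mem_nhds (hS.mem_nhds hp)] with z hz
    have hd : DifferentiableAt ℝ η (z.1, z.2.1) :=
      differentiableAt_euclidean.2 fun i => diffAt hS (hη i) hz
    rw [← totalDeriv_apply hd]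
    simp

theorem differentiableAt_firstProlongation (hJ : IsOpen J)
    (hξ : ContDiffOn ℝ ∞ ξ (J ×ˢ (U : Set (Coord n))))
    (hη : ∀ i, ContDiffOn ℝ ∞ (fun q => η q i) (J ×ˢ (U : Set (Coord n))))
    {p : ℝ × Coord n × Coord n} (hp : (p.1, p.2.1) ∈ J ×ˢ (U : Set (Coord n))) :
    DifferentiableAt ℝ (firstProlongation ξ η) p := by
  have hS : IsOpen (J ×ˢ (U : Set (Coord n))) := hJ.prod U.2
  refine (hasDir_base (u := 0) (diffAt hS hξ hp)).diff.prodMk (DifferentiableAt.prodMk ?_ ?_)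
  · exact differentiableAt_euclidean.2 fun i => (hasDir_base (u := 0) (diffAt hS (hη i) hp)).diff
  · exact differentiableAt_euclidean.2 fun i => (hasDir_prolongation (u := 0) hJ hξ hη hp i).diff

theorem lieDerivConnection_slice (hJ : IsOpen J)
    (hη : ∀ i, ContDiffOn ℝ ∞ (fun q => η q i) (J ×ˢ (U : Set (Coord n))))
    {t : ℝ} (ht : t ∈ J) {y : Coord n} (hy : y ∈ U) (i j k : Fin n) :
    lieDerivConnection G (fun z => η (t, z)) i j k y = dx j (dx k fun q => η q i) (t, y) +
      ∑ l, (η (t, y) l * pd l (christoffel G i j k) y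
        + christoffel G i l j y * dx k (fun q => η q l) (t, y)
        + christoffel G i l k y * dx j (fun q => η q l) (t, y)
        - christoffel G l j k y * dx l (fun q => η q i) (t, y)) := by
  have h (l k : Fin n) : pd k (fun z => η (t, z) l) y = dx k (fun q => η q l) (t, y) :=
    pd_slice (diffAt (hJ.prod U.2) (hη l) ⟨ht, hy⟩) k
  simp only [lieDerivConnection, h]
  rw [pd_pd_slice hJ U.2 (hη i) ht hy j k]

theorem covHessian_slice (hJ : IsOpen J) (hξ : ContDiffOn ℝ ∞ ξ (J ×ˢ (U : Set (Coord n))))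
    {t : ℝ} (ht : t ∈ J) {y : Coord n} (hy : y ∈ U) (j k : Fin n) :
    covHessian G (fun z => ξ (t, z)) j k y = dx j (dx k ξ) (t, y) -
      ∑ i, christoffel G i j k y * dx i ξ (t, y) := by
  have h (k : Fin n) : pd k (fun z => ξ (t, z)) y = dx k ξ (t, y) :=
    pd_slice (diffAt (hJ.prod U.2) hξ ⟨ht, hy⟩) k
  simp only [covHessian, h]
  rw [pd_pd_slice hJ U.2 hξ ht hy j k]

theorem dt_dx (hJ : IsOpen J) {f : ℝ × Coord n → ℝ}
    (hf : ContDiffOn ℝ ∞ f (J ×ˢ (U : Set (Coord n))))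
    {t : ℝ} (ht : t ∈ J) {y : Coord n} (hy : y ∈ U) (k : Fin n) :
    dt (dx k f) (t, y) = dx k (dt f) (t, y) :=
  dir_comm (hJ.prod U.2) hf ⟨ht, hy⟩ _ _

/-- The second total derivative along the geodesic flow, collected in powers of the velocity. -/
theorem collect_second (ftt : ℝ) (ft fx v q : Fin n → ℝ) (fxx : Fin n → Fin n → ℝ) :
    (1 * ftt + ∑ k, v k * ft k) + ∑ k, (v k * (1 * ft k + ∑ j, v j * fxx j k) + fx k * (- q k)) =
      ftt + 2 * (∑ k, v k * ft k) + ∑ j, ∑ k, v j * v k * fxx j k - ∑ k, fx k * q k := by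
  have s1 : ∑ k, v k * ∑ j, v j * fxx j k = ∑ j, ∑ k, v j * v k * fxx j k := by
    simp only [Finset.mul_sum]
    rw [Finset.sum_comm]
    exact Finset.sum_congr rfl fun j _ => Finset.sum_congr rfl fun k _ => by ring
  simp only [one_mul, mul_add, mul_neg, Finset.sum_add_distrib, Finset.sum_neg_distrib, s1]
  ring

theorem collect_velocity (Γ : Fin n → Fin n → ℝ) (hΓ : ∀ j k, Γ j k = Γ k j)
    (a v τ : Fin n → ℝ) (b : Fin n → Fin n → ℝ) (hτ : ∀ k, τ k = a k + ∑ l, v l * b k l) :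
    ∑ j, ∑ k, Γ j k * v j * τ k =
      ∑ k, v k * ∑ j, Γ j k * a j + ∑ j, ∑ k, Γ j k * v j * ∑ l, v l * b k l := by
  rw [← Finset.sum_add_distrib]
  refine Finset.sum_congr rfl fun j _ => ?_
  rw [Finset.mul_sum, ← Finset.sum_add_distrib]
  refine Finset.sum_congr rfl fun k _ => ?_
  rw [hτ, hΓ k j]; ring

theorem sum_covHessian (Γ : Fin n → Fin n → Fin n → ℝ) (v w : Fin n → ℝ) (B : Fin n → Fin n → ℝ) :
    ∑ j, ∑ k, v j * v k * (B j k - ∑ l, Γ l j k * w l) =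
      ∑ j, ∑ k, v j * v k * B j k - ∑ l, w l * ∑ j, ∑ k, Γ l j k * v j * v k := by
  have s3 : ∑ j, ∑ k, v j * v k * ∑ l, Γ l j k * w l =
      ∑ l, w l * ∑ j, ∑ k, Γ l j k * v j * v k := by
    simp only [Finset.mul_sum]
    rw [Finset.sum_comm (f := fun l j => ∑ k, w l * (Γ l j k * v j * v k))]
    refine Finset.sum_congr rfl fun j _ => ?_
    rw [Finset.sum_comm]
    refine Finset.sum_congr rfl fun l _ => Finset.sum_congr rfl fun k _ => by ring
  simp only [mul_sub, Finset.sum_sub_distrib, s3]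

/-- The geodesic operator has constant `∂_t` component 1 and `∂_x` component `v`. So the bracket has
`∂_t` component `-dξ/dt` and `∂_x` component `(dη/dt - v dξ/dt) - dη/dt`, which is already `-dξ/dt`
times the operator; `determining` is the defect in the velocity components. -/
theorem lieBracket_components (hJ : IsOpen J) (hG : IsMetricOn G U)
    (hξ : ContDiffOn ℝ ∞ ξ (J ×ˢ (U : Set (Coord n))))
    (hη : ∀ i, ContDiffOn ℝ ∞ (fun q => η q i) (J ×ˢ (U : Set (Coord n))))
    {t : ℝ} (ht : t ∈ J) {y : Coord n} (hy : y ∈ U) (v : Coord n) :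
    (VectorField.lieBracket ℝ (firstProlongation ξ η) (geodesicOperator G) (t, y, v)).1 =
      - totalDeriv ξ (t, y, v) ∧
    (VectorField.lieBracket ℝ (firstProlongation ξ η) (geodesicOperator G) (t, y, v)).2.1 =
      - totalDeriv ξ (t, y, v) • v ∧
    ∀ i, (VectorField.lieBracket ℝ (firstProlongation ξ η) (geodesicOperator G) (t, y, v)).2.2 i =
      - totalDeriv ξ (t, y, v) * geodesicRHS G y v i + determining G ξ η t y v i := by
  set p : ℝ × Coord n × Coord n := (t, y, v) with hpdef
  have hS : IsOpen (J ×ˢ (U : Set (Coord n))) := hJ.prod U.2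
  have hp : (p.1, p.2.1) ∈ J ×ˢ (U : Set (Coord n)) := ⟨ht, hy⟩
  have hV := differentiableAt_firstProlongation hJ hξ hη hp
  have hW := differentiableAt_geodesicOperator hG (p := p) hy
  have hcomp (L : ℝ × Coord n × Coord n →L[ℝ] ℝ) :
      L (VectorField.lieBracket ℝ (firstProlongation ξ η) (geodesicOperator G) p) =
        fderiv ℝ (fun z => L (geodesicOperator G z)) p (firstProlongation ξ η p) -
        fderiv ℝ (fun z => L (firstProlongation ξ η z)) p (geodesicOperator G p) := by
    rw [VectorField.lieBracket, map_sub, clm_fderiv L hW, clm_fderiv L hV]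
  have hT (f : ℝ × Coord n → ℝ) : dt f (p.1, p.2.1) + ∑ k, v k * dx k f (p.1, p.2.1) =
      totalDeriv f p := (totalDeriv_eq f p).symm
  have hηd : DifferentiableAt ℝ η (p.1, p.2.1) :=
    differentiableAt_euclidean.2 fun i => diffAt hS (hη i) hp
  have hbase (f : ℝ × Coord n → ℝ) (hf : ContDiffOn ℝ ∞ f (J ×ˢ (U : Set (Coord n)))) :
      fderiv ℝ (fun z : ℝ × Coord n × Coord n => f (z.1, z.2.1)) p (geodesicOperator G p) =
        totalDeriv f p := by
    rw [(hasDir_base (diffAt hS hf hp)).eq, ← hT]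
    simp only [geodesicOperator, one_mul]
    rfl
  refine ⟨?_, ?_, fun i => ?_⟩
  · have h := hcomp (ContinuousLinearMap.fst ℝ ℝ (Coord n × Coord n))
    have h1 : fderiv ℝ (fun z : ℝ × Coord n × Coord n =>
        (ContinuousLinearMap.fst ℝ ℝ (Coord n × Coord n)) (geodesicOperator G z)) p = 0 := by
      simp only [geodesicOperator, ContinuousLinearMap.coe_fst']
      exact fderiv_const_apply _
    rw [h1] at h
    refine h.trans ?_
    rw [zero_apply, zero_sub]
    exact congrArg Neg.neg (hbase ξ hξ)
  · ext i
    have h := hcomp ((EuclideanSpace.proj i).comp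
      ((ContinuousLinearMap.fst ℝ (Coord n) (Coord n)).comp
        (ContinuousLinearMap.snd ℝ ℝ (Coord n × Coord n))))
    refine h.trans ?_
    have h1 := (hasDir_vel (p := p) (u := firstProlongation ξ η p) i).eq
    have h2 := hbase _ (hη i)
    refine (congrArg₂ (· - ·) h1 h2).trans ?_
    simp only [firstProlongation, ← totalDeriv_apply hηd]
    simp [hpdef]
  · have h := hcomp (velCoord i)
    refine h.trans ?_
    have h1 := (hasDir_geodesicRHS (p := p) (u := firstProlongation ξ η p) hG hy i).eq
    have h2 := (hasDir_prolongation (p := p) (u := geodesicOperator G p) hJ hξ hη hp i).eq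
    refine (congrArg₂ (· - ·) h1 h2).trans ?_
    -- Here `φ = dη/dt - v dξ/dt` is the velocity part of the prolongation, with `τ = dη/dt` and `c
    -- = dξ/dt`.
    rw [collect_quadratic (fun j k => christoffel G i j k p.2.1)
      (fun j k => hG.christoffel_symm i j k _) _ _
      (fun j => totalDeriv (fun z => η z j) p) _ (totalDeriv ξ p) (fun j => by
        simp only [firstProlongation, ← totalDeriv_apply hηd]; simp [hpdef])]
    rw [(hasDir_totalDeriv hS (hη i) hp).eq, (hasDir_totalDeriv hS hξ hp).eq]
    have hω (l : Fin n) : (geodesicOperator G p).2.2 l =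
        - ∑ j, ∑ k, christoffel G l j k y * v j * v k := rfl
    have hω' : geodesicRHS G y v i = - ∑ j, ∑ k, christoffel G i j k y * v j * v k := rfl
    have hu1 : (geodesicOperator G p).1 = 1 := rfl
    have hu2 : (geodesicOperator G p).2.1 = v := rfl
    have hp1 : p.1 = t := rfl
    have hp2 : p.2.1 = y := rfl
    have hp3 : p.2.2 = v := rfl
    have hφ : (firstProlongation ξ η p).2.1 = η (t, y) := rfl
    simp only [hω, hu1, hu2, hp1, hp2, hp3, hφ, hω', dt_dx hJ hξ ht hy, dt_dx hJ (hη i) ht hy,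
      collect_second]
    rw [collect_velocity (fun j k => christoffel G i j k y)
      (fun j k => hG.christoffel_symm i j k _) (fun j => dt (fun q => η q j) (t, y)) v _
      (fun j l => dx l (fun q => η q j) (t, y)) (fun k => totalDeriv_eq _ _)]
    unfold determining
    simp only [lieDerivConnection_slice hJ hη ht hy, covHessian_slice hJ hξ ht hy]
    rw [sum_covHessian (fun l j k => christoffel G l j k y) v,
      sum_lieDeriv (fun l j k => christoffel G l j k y) (fun l j k => hG.christoffel_symm l j k y)
      _ (fun j k => dx j (dx k fun q => η q i) (t, y)) v (η (t, y))
      (fun l j k => pd l (christoffel G i j k) y) (fun j k => rfl)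
      (fun l k => dx k (fun q => η q l) (t, y)) i]
    simp only [mul_add, Finset.sum_add_distrib]
    ring

end DeterminingEquations

/-! ### Solution of the determining equations in a proper Einstein space. -/

section SolveDetermining

variable {n : ℕ}

/-- A cubic is determined by its values at `0`, `1`, `-1` and `2`. -/
theorem cubic_coeffs_eq_zero {a b c d : ℝ} (h : ∀ s : ℝ, a + s * b + s ^ 2 * c + s ^ 3 * d = 0) :
    a = 0 ∧ b = 0 ∧ c = 0 ∧ d = 0 := by
  have h0 := h 0
  have h1 := h 1
  have h2 := h (-1)
  have h3 := h 2
  norm_num at h0 h1 h2 h3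
  refine ⟨h0, ?_, ?_, ?_⟩ <;> linarith

/-- A symmetric matrix with vanishing quadratic form vanishes. -/
theorem eq_zero_of_quadratic {H : Fin n → Fin n → ℝ} (hH : ∀ j k, H j k = H k j)
    (h : ∀ v : Coord n, ∑ j, ∑ k, v j * v k * H j k = 0) (a b : Fin n) : H a b = 0 := by
  have e (a b : Fin n) : ∑ j, ∑ k, (EuclideanSpace.single a (1 : ℝ) : Coord n) j *
      (EuclideanSpace.single b (1 : ℝ) : Coord n) k * H j k = H a b := by
    simp
  have h1 := h (EuclideanSpace.single a 1)
  have h2 := h (EuclideanSpace.single b 1)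
  -- Polarization: the diagonal values vanish, so the cross terms `H a b + H b a` vanish too.
  have h3 := h (EuclideanSpace.single a 1 + EuclideanSpace.single b 1)
  rw [e] at h1 h2
  simp only [PiLp.add_apply, add_mul, mul_add, Finset.sum_add_distrib] at h3
  rw [e, e, e, e, h1, h2, hH b a] at h3
  linarith

variable {J : Set ℝ} {U : TopologicalSpace.Opens (Coord n)}
  {G : Coord n → Matrix (Fin n) (Fin n) ℝ} {ξ : ℝ × Coord n → ℝ} {η : ℝ × Coord n → Coord n}

/-- Scaling the velocity by `s` separates the homogeneous parts, which then vanish one by one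
through `cubic_coeffs_eq_zero`. -/
theorem determining_smul (t : ℝ) (y v : Coord n) (i : Fin n) (s : ℝ) :
    determining G ξ η t y (s • v) i =
      - dt (dt fun q => η q i) (t, y)
      + s * (dt (dt ξ) (t, y) * v i - 2 * ∑ k, v k * (dx k (dt fun q => η q i) (t, y)
          + ∑ j, christoffel G i j k y * dt (fun q => η q j) (t, y)))
      + s ^ 2 * (2 * (∑ k, v k * dx k (dt ξ) (t, y)) * v i
          - ∑ j, ∑ k, v j * v k * lieDerivConnection G (fun z => η (t, z)) i j k y)
      + s ^ 3 * ((∑ j, ∑ k, v j * v k * covHessian G (fun z => ξ (t, z)) j k y) * v i) := by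
  have e1 (X : Fin n → ℝ) : ∑ k, (s • v) k * X k = s * ∑ k, v k * X k := by
    rw [Finset.mul_sum]
    exact Finset.sum_congr rfl fun k _ => by simp [mul_assoc]
  have e2 (X : Fin n → Fin n → ℝ) :
      ∑ j, ∑ k, (s • v) j * (s • v) k * X j k = s ^ 2 * ∑ j, ∑ k, v j * v k * X j k := by
    simp only [Finset.mul_sum]
    refine Finset.sum_congr rfl fun j _ => Finset.sum_congr rfl fun k _ => ?_
    simp only [PiLp.smul_apply, smul_eq_mul]
    ring
  simp only [determining, e1, e2]
  simp only [PiLp.smul_apply, smul_eq_mul]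
  ring

/-- The solutions of the determining equations in a proper Einstein space. -/
structure IsReducedSymmetry (G : Coord n → Matrix (Fin n) (Fin n) ℝ) (ξ : ℝ × Coord n → ℝ)
    (η : ℝ × Coord n → Coord n) (J : Set ℝ) (U : TopologicalSpace.Opens (Coord n)) : Prop where
  dx_time : ∀ t ∈ J, ∀ y ∈ U, ∀ k, dx k ξ (t, y) = 0
  dt_dt_time : ∀ t ∈ J, ∀ y ∈ U, dt (dt ξ) (t, y) = 0
  dt_space : ∀ t ∈ J, ∀ y ∈ U, ∀ i, dt (fun q => η q i) (t, y) = 0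
  affine : ∀ t ∈ J, ∀ y ∈ U, ∀ i j k, lieDerivConnection G (fun z => η (t, z)) i j k y = 0

theorem slice_smooth {f : ℝ × Coord n → ℝ} (hf : ContDiffOn ℝ ∞ f (J ×ˢ (U : Set (Coord n))))
    {t : ℝ} (ht : t ∈ J) : ContDiffOn ℝ ∞ (fun y => f (t, y)) (U : Set (Coord n)) :=
  hf.comp (contDiffOn_const.prodMk contDiffOn_id) fun _ hy => ⟨ht, hy⟩

theorem covHessian_symm (hG : IsMetricOn G U) {f : Coord n → ℝ}
    (hf : ContDiffOn ℝ ∞ f U) {y : Coord n} (hy : y ∈ U) (j k : Fin n) :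
    covHessian G f j k y = covHessian G f k j y := by
  unfold covHessian
  rw [pd_comm U.2 hf hy]
  simp only [fun i => hG.christoffel_symm i j k y]

theorem lieDerivConnection_symm (hG : IsMetricOn G U) {X : Coord n → Coord n}
    (hX : ∀ i, ContDiffOn ℝ ∞ (fun y => X y i) U) {y : Coord n} (hy : y ∈ U) (i j k : Fin n) :
    lieDerivConnection G X i j k y = lieDerivConnection G X i k j y := by
  have h := congrArg (smoothEval ⟨y, hy⟩)
    (lieConn_swap pdDer_comm hG.conn_symm (fieldMk X hX) i j k)
  rwa [hG.eval_lieConn, hG.eval_lieConn] at h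

/-- The homogeneous parts are used from degree three downwards, because each step removes a term
from the next: `Hess ξ = 0` gives `∂ₖ ξ = 0`, which removes `∂ₖ ξ_t` from the quadratic part and
makes `ξ_tt` constant in space for the linear part. Degree zero, `η_tt = 0`, gives nothing new. -/
theorem IsReducedSymmetry.of_determining (hn : 2 < n) (hJ : IsOpen J) (hG : IsMetricOn G U)
    (hE : IsEinsteinOn G U) (hξ : ContDiffOn ℝ ∞ ξ (J ×ˢ (U : Set (Coord n))))
    (hη : ∀ i, ContDiffOn ℝ ∞ (fun q => η q i) (J ×ˢ (U : Set (Coord n))))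
    (h : ∀ t ∈ J, ∀ y ∈ U, ∀ v i, determining G ξ η t y v i = 0) :
    IsReducedSymmetry G ξ η J U := by
  have hS : IsOpen (J ×ˢ (U : Set (Coord n))) := hJ.prod U.2
  have hc (t) (ht : t ∈ J) (y) (hy : y ∈ U) (v : Coord n) (i) := cubic_coeffs_eq_zero fun s =>
    (determining_smul (G := G) (ξ := ξ) (η := η) t y v i s).symm.trans (h t ht y hy _ i)
  have hHess (t) (ht : t ∈ J) (y) (hy : y ∈ U) (j k) :
      covHessian G (fun z => ξ (t, z)) j k y = 0 := by
    refine eq_zero_of_quadratic (fun j k => covHessian_symm hG (slice_smooth hξ ht) hy j k)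
      (fun v => ?_) j k
    -- The cubic part is the quadratic form of the Hessian times `v i`; a nonzero component of `v`
    -- is needed to cancel.
    by_cases hv : v = 0
    · simp [hv]
    · obtain ⟨i, hi⟩ : ∃ i, v i ≠ 0 := by
        by_contra hcon
        push Not at hcon
        exact hv (by ext i; simpa using hcon i)
      exact (mul_eq_zero.mp (hc t ht y hy v i).2.2.2).resolve_right hi
  have hdx (t) (ht : t ∈ J) (y) (hy : y ∈ U) (k) : dx k ξ (t, y) = 0 := by
    rw [← pd_slice (diffAt hS hξ ⟨ht, hy⟩)]
    exact pd_eq_zero_of_covHessian hn hG hE (slice_smooth hξ ht) (hHess t ht) hy k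
  have hdxt (k) (q) (hq : q ∈ J ×ˢ (U : Set (Coord n))) : dx k (dt ξ) q = 0 :=
    dx_dt_eq_zero hS hξ (fun q hq => hdx q.1 hq.1 q.2 hq.2 k) hq
  have hdxtt (k) (q) (hq : q ∈ J ×ˢ (U : Set (Coord n))) : dx k (dt (dt ξ)) q = 0 :=
    dx_dt_eq_zero hS (contDiffOn_dt hS hξ) (fun q hq => hdxt k q hq) hq
  have haff (t) (ht : t ∈ J) (y) (hy : y ∈ U) (i j k) :
      lieDerivConnection G (fun z => η (t, z)) i j k y = 0 := by
    refine eq_zero_of_quadratic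
      (fun j k => lieDerivConnection_symm hG (fun i => slice_smooth (hη i) ht) hy i j k)
      (fun v => ?_) j k
    have h2 := (hc t ht y hy v i).2.2.1
    have h3 : ∑ k, v k * dx k (dt ξ) (t, y) = 0 :=
      Finset.sum_eq_zero fun k _ => by rw [hdxt k (t, y) ⟨ht, hy⟩, mul_zero]
    rw [h3] at h2
    linarith
  have hlin (t) (ht : t ∈ J) (y) (hy : y ∈ U) (i k) : dx k (dt fun q => η q i) (t, y)
      + ∑ j, christoffel G i j k y * dt (fun q => η q j) (t, y) =
      if i = k then (1 / 2) * dt (dt ξ) (t, y) else 0 := by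
    have h1 := (hc t ht y hy (EuclideanSpace.single k 1) i).2.1
    simp only [PiLp.single_apply, ite_mul, one_mul, zero_mul, Finset.sum_ite_eq',
      Finset.mem_univ, if_true] at h1
    split_ifs at h1 ⊢ <;> linarith
  have hdt (t) (ht : t ∈ J) (y) (hy : y ∈ U) (i) : dt (fun q => η q i) (t, y) = 0 := by
    have hsm (i) := slice_smooth (contDiffOn_dt hS (hη i)) ht
    have hc := slice_smooth (contDiffOn_dt hS (contDiffOn_dt hS hξ)) ht
    -- By `hlin`, `∇η_t = c·id` with `c = ½ ξ_tt`, and `hdxtt` says that `c` is constant in space.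
    have h0 := eq_zero_of_covVec hn hG hE (c := algebraMap ℝ _ (1 / 2) * smoothMk _ hc)
      (Z := fun i => smoothMk _ (hsm i)) (fun k => by
        have hz : pdDer U k (smoothMk _ hc) = 0 := smoothFun_ext fun y => by
          rw [smoothEval_pdDer_smoothMk, pd_slice (diffAt hS (contDiffOn_dt hS
            (contDiffOn_dt hS hξ)) ⟨ht, y.2⟩), hdxtt k _ ⟨ht, y.2⟩, map_zero]
        rw [Derivation.leibniz, hz, Derivation.map_algebraMap, smul_zero, smul_zero, add_zero])
      fun k i => smoothFun_ext fun y => by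
        have h2 := hlin t ht y y.2 i k
        simp only [covVec, IsMetricOn.conn, Matrix.of_apply, pdDer_smoothMk, map_add,
          map_sum, map_mul, smoothEval_smoothMk]
        rw [pd_slice (diffAt hS (contDiffOn_dt hS (hη i)) ⟨ht, y.2⟩), h2]
        split_ifs <;> rfl
    exact congrArg (smoothEval ⟨y, hy⟩) (congrFun h0 i)
  refine ⟨hdx, fun t ht y hy => ?_, hdt, haff⟩
  -- Any diagonal entry of the linear part, once `η_t = 0`, reads `0 = ½ ξ_tt`; the index `0` exists
  -- since `n > 2`.
  have h2 := hlin t ht y hy ⟨0, by omega⟩ ⟨0, by omega⟩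
  have h3 : dx ⟨0, by omega⟩ (dt fun q => η q ⟨0, by omega⟩) (t, y) = 0 :=
    dir_eq_zero_of_eq_zero hS (fun q hq => hdt q.1 hq.1 q.2 hq.2 _) (q := (t, y)) ⟨ht, hy⟩ _
  simp only [hdt t ht y hy, mul_zero, Finset.sum_const_zero, h3, if_true] at h2
  linarith

theorem IsReducedSymmetry.determining (hJ : IsOpen J)
    (hξ : ContDiffOn ℝ ∞ ξ (J ×ˢ (U : Set (Coord n))))
    (h : IsReducedSymmetry G ξ η J U) {t : ℝ} (ht : t ∈ J) {y : Coord n} (hy : y ∈ U)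
    (v : Coord n) (i : Fin n) : determining G ξ η t y v i = 0 := by
  have hS : IsOpen (J ×ˢ (U : Set (Coord n))) := hJ.prod U.2
  have h1 (i) : dt (dt fun q => η q i) (t, y) = 0 :=
    dir_eq_zero_of_eq_zero hS (fun q hq => h.dt_space q.1 hq.1 q.2 hq.2 i) ⟨ht, hy⟩ _
  have h2 (i k) : dx k (dt fun q => η q i) (t, y) = 0 :=
    dir_eq_zero_of_eq_zero hS (fun q hq => h.dt_space q.1 hq.1 q.2 hq.2 i) ⟨ht, hy⟩ _
  have h3 (k) : dx k (dt ξ) (t, y) = 0 :=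
    dx_dt_eq_zero hS hξ (fun q hq => h.dx_time q.1 hq.1 q.2 hq.2 k) ⟨ht, hy⟩
  have h4 (j k) : dx j (dx k ξ) (t, y) = 0 :=
    dir_eq_zero_of_eq_zero hS (fun q hq => h.dx_time q.1 hq.1 q.2 hq.2 k) ⟨ht, hy⟩ _
  simp only [GeodesicSymmetry.determining, h1, h2, h3, h4, h.dt_space t ht y hy,
    h.affine t ht y hy, h.dt_dt_time t ht y hy, covHessian_slice hJ hξ ht hy, h.dx_time t ht y hy]
  simp

/-- The bracket condition of a point symmetry is equivalent to the reduced determining equations. -/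
theorem lieBracket_condition_iff (hn : 2 < n) (hJ : IsOpen J) (hG : IsMetricOn G U)
    (hE : IsEinsteinOn G U) (hξ : ContDiffOn ℝ ∞ ξ (J ×ˢ (U : Set (Coord n))))
    (hη : ∀ i, ContDiffOn ℝ ∞ (fun q => η q i) (J ×ˢ (U : Set (Coord n)))) :
    (∃ lam : ℝ × Coord n × Coord n → ℝ, ∀ t ∈ J, ∀ y ∈ U, ∀ v : Coord n,
      VectorField.lieBracket ℝ (firstProlongation ξ η) (geodesicOperator G) (t, y, v) =
        lam (t, y, v) • geodesicOperator G (t, y, v)) ↔ IsReducedSymmetry G ξ η J U := by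
  constructor
  · rintro ⟨lam, h⟩
    refine IsReducedSymmetry.of_determining hn hJ hG hE hξ hη fun t ht y hy v i => ?_
    obtain ⟨h1, -, h3⟩ := lieBracket_components hJ hG hξ hη ht hy v
    have h3 := h3 i
    rw [h t ht y hy v] at h1 h3
    -- The `∂_t` component of the geodesic operator is 1, so this component identifies `lam`.
    have h1 : lam (t, y, v) * 1 = - totalDeriv ξ (t, y, v) := h1
    have h3 : lam (t, y, v) * geodesicRHS G y v i = _ := h3
    rw [← h1, mul_one] at h3
    linarith
  · intro h
    refine ⟨fun p => - totalDeriv ξ p, fun t ht y hy v => ?_⟩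
    obtain ⟨h1, h2, h3⟩ := lieBracket_components hJ hG hξ hη ht hy v
    refine Prod.ext (h1.trans (mul_one _).symm) (Prod.ext h2 ?_)
    ext i
    rw [h3, h.determining hJ hξ ht hy, add_zero]
    rfl

end SolveDetermining

/-! ### Coordinate expressions of functions, fields and metrics on the manifold. -/

section Charts

variable {n : ℕ} {M : Type*} [TopologicalSpace M] {e : OpenPartialHomeomorph M (Coord n)}

/-- The domain of the coordinates, as an open set of the coordinate space. -/
def chartOpens (e : OpenPartialHomeomorph M (Coord n)) : TopologicalSpace.Opens (Coord n) :=
  ⟨e.target, e.open_target⟩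

/-- The part of the coordinate domain lying over an open subset of the manifold. -/
def chartOpensOver (e : OpenPartialHomeomorph M (Coord n)) {U : Set M} (hU : IsOpen U) :
    TopologicalSpace.Opens (Coord n) :=
  ⟨e.target ∩ e.symm ⁻¹' U, e.symm.isOpen_inter_preimage hU⟩

theorem chartOpensOver_le {U : Set M} (hU : IsOpen U) :
    chartOpensOver e hU ≤ chartOpens e := fun _ hy => hy.1

variable [ChartedSpace (Coord n) M]

theorem chart_mdifferentiable (he : e ∈ IsManifold.maximalAtlas (𝓡 n) ∞ M) :
    e.MDifferentiable (𝓡 n) (𝓡 n) :=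
  ⟨(contMDiffOn_of_mem_maximalAtlas he).mdifferentiableOn (by simp),
    (contMDiffOn_symm_of_mem_maximalAtlas he).mdifferentiableOn (by simp)⟩

theorem scalar_smooth {J : Set ℝ} {ξ : ℝ → M → ℝ}
    (hξ : ContMDiffOn (𝓘(ℝ, ℝ).prod (𝓡 n)) 𝓘(ℝ, ℝ) ∞ (fun p : ℝ × M => ξ p.1 p.2)
      (J ×ˢ Set.univ))
    (he : e ∈ IsManifold.maximalAtlas (𝓡 n) ∞ M) :
    ContDiffOn ℝ ∞ (fun q : ℝ × Coord n => ξ q.1 (e.symm q.2)) (J ×ˢ e.target) := by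
  have h2 : ContMDiffOn (𝓘(ℝ, ℝ).prod (𝓡 n)) (𝓘(ℝ, ℝ).prod (𝓡 n)) ∞
      (fun q : ℝ × Coord n => (q.1, e.symm q.2)) (J ×ˢ e.target) :=
    contMDiffOn_fst.prodMk ((contMDiffOn_symm_of_mem_maximalAtlas he).comp contMDiffOn_snd
      fun q hq => hq.2)
  -- The product manifold structure on `ℝ × Coord n` has to be identified with its structure as a
  -- vector space.
  rw [← contMDiffOn_iff_contDiffOn, modelWithCornersSelf_prod, ← chartedSpaceSelf_prod]
  exact hξ.comp h2 fun q hq => ⟨hq.1, Set.mem_univ _⟩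

theorem scalarCoord_smooth {S : M → ℝ} {U : Set M}
    (hS : ContMDiffOn (𝓡 n) 𝓘(ℝ, ℝ) ∞ S U) (he : e ∈ IsManifold.maximalAtlas (𝓡 n) ∞ M) :
    ContDiffOn ℝ ∞ (fun y => S (e.symm y)) (e.target ∩ e.symm ⁻¹' U) := by
  rw [← contMDiffOn_iff_contDiffOn]
  exact hS.comp ((contMDiffOn_symm_of_mem_maximalAtlas he).mono Set.inter_subset_left)
    fun y hy => hy.2

theorem vecCoord_injective (he : e ∈ IsManifold.maximalAtlas (𝓡 n) ∞ M)
    {X Y : ∀ x : M, TangentSpace (𝓡 n) x} {y : Coord n} (hy : y ∈ e.target)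
    (h : vecCoord e X y = vecCoord e Y y) : X (e.symm y) = Y (e.symm y) :=
  (chart_mdifferentiable he).mfderiv_injective (e.map_target hy) h

variable [IsManifold (𝓡 n) ∞ M]

/-- Coordinate vector fields are smooth. -/
theorem contMDiffOn_coordField (he : e ∈ IsManifold.maximalAtlas (𝓡 n) ∞ M) (w : Coord n) :
    ContMDiffOn (𝓡 n) (𝓡 n).tangent ∞ (fun y : Coord n =>
      (⟨e.symm y, mfderiv (𝓡 n) (𝓡 n) e.symm y w⟩ : TangentBundle (𝓡 n) M)) e.target := by
  have h1 := (contMDiffOn_symm_of_mem_maximalAtlas he).contMDiffOn_tangentMapWithin (m := ∞)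
    (by simp) e.open_target.uniqueMDiffOn
  have h2 : ContMDiffOn (𝓡 n) (𝓡 n).tangent ∞
      (fun y : Coord n => (⟨y, w⟩ : TangentBundle (𝓡 n) (Coord n))) e.target :=
    contMDiffOn_vectorSpace_iff_contDiffOn.2 contDiffOn_const
  refine (h1.comp h2 fun y hy => hy).congr fun y hy => ?_
  simp only [Function.comp_apply, tangentMapWithin, mfderivWithin_of_isOpen e.open_target hy]

theorem metricCoord_smooth (g : PseudoRiemannianMetric n M)
    (he : e ∈ IsManifold.maximalAtlas (𝓡 n) ∞ M) (i j : Fin n) :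
    ContDiffOn ℝ ∞ (fun y => metricCoord g e y i j) e.target := by
  have hg := g.contMDiff.comp_contMDiffOn (contMDiffOn_symm_of_mem_maximalAtlas he)
  have h := ContMDiffOn.clm_bundle_apply₂ (F₃ := ℝ) (E₃ := Bundle.Trivial M ℝ) hg
    (contMDiffOn_coordField he (EuclideanSpace.single i 1))
    (contMDiffOn_coordField he (EuclideanSpace.single j 1))
  rw [← contMDiffOn_iff_contDiffOn]
  intro y hy
  exact (Bundle.contMDiffWithinAt_totalSpace.1 (h y hy)).2

/-- The coordinate components of a time-dependent vector field are smooth. -/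
theorem vecCoord_smooth {J : Set ℝ} {η : ℝ → ∀ x : M, TangentSpace (𝓡 n) x}
    (hη : ContMDiffOn (𝓘(ℝ, ℝ).prod (𝓡 n)) (𝓡 n).tangent ∞
      (fun p : ℝ × M => (⟨p.2, η p.1 p.2⟩ : TangentBundle (𝓡 n) M)) (J ×ˢ Set.univ))
    (he : e ∈ IsManifold.maximalAtlas (𝓡 n) ∞ M) :
    ContDiffOn ℝ ∞ (fun q : ℝ × Coord n => vecCoord e (η q.1) q.2) (J ×ˢ e.target) := by
  have h1 := (contMDiffOn_of_mem_maximalAtlas he).contMDiffOn_tangentMapWithin (m := ∞)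
    (by simp) e.open_source.uniqueMDiffOn
  have h2 : ContMDiffOn (𝓘(ℝ, ℝ).prod (𝓡 n)) (𝓘(ℝ, ℝ).prod (𝓡 n)) ∞
      (fun q : ℝ × Coord n => (q.1, e.symm q.2)) (J ×ˢ e.target) :=
    contMDiffOn_fst.prodMk ((contMDiffOn_symm_of_mem_maximalAtlas he).comp contMDiffOn_snd
      fun q hq => hq.2)
  have h3 := hη.comp h2 fun q hq => ⟨hq.1, Set.mem_univ _⟩
  have h4 := (contMDiff_snd_tangentBundle_modelSpace (Coord n) (𝓡 n) (n := ∞)).comp_contMDiffOn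
    (h1.comp h3 fun q hq => e.map_target hq.2)
  rw [← contMDiffOn_iff_contDiffOn, modelWithCornersSelf_prod, ← chartedSpaceSelf_prod]
  refine h4.congr fun q hq => ?_
  change _ = (mfderivWithin (𝓡 n) (𝓡 n) e e.source (e.symm q.2)) (η q.1 (e.symm q.2))
  rw [mfderivWithin_of_isOpen e.open_source (e.map_target hq.2)]
  rfl

/-- A kernel vector of the matrix is sent by the differential of `e.symm` to a vector orthogonal to
all coordinate vectors, hence to the whole tangent space; nondegeneracy and injectivity of the
differential make it zero. -/
theorem metricCoord_det (g : PseudoRiemannianMetric n M)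
    (he : e ∈ IsManifold.maximalAtlas (𝓡 n) ∞ M) {y : Coord n} (hy : y ∈ e.target) :
    (metricCoord g e y).det ≠ 0 := by
  intro hdet
  obtain ⟨v, hv, hmv⟩ := Matrix.exists_mulVec_eq_zero_iff.2 hdet
  set T : Coord n →L[ℝ] TangentSpace (𝓡 n) (e.symm y) := mfderiv (𝓡 n) (𝓡 n) e.symm y with hT
  have hinj : Function.Injective T := (chart_mdifferentiable he).symm.mfderiv_injective hy
  have hsurj : Function.Surjective T := (chart_mdifferentiable he).symm.mfderiv_surjective hy
  have hzero (i : Fin n) : g.inner (e.symm y) (T (EuclideanSpace.single i (1 : ℝ)))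
      (T (WithLp.toLp 2 v)) = 0 := by
    refine Eq.trans ?_ (congrFun hmv i)
    refine (clm_eq_sum ((g.inner (e.symm y) (T (EuclideanSpace.single i 1))).comp T) _).trans ?_
    exact Finset.sum_congr rfl fun k _ => mul_comm _ _
  have hu : T (WithLp.toLp 2 v) = 0 := by
    refine g.nondegenerate _ _ fun w => ?_
    obtain ⟨w, rfl⟩ := hsurj w
    refine (clm_eq_sum ((g.inner (e.symm y) (T (WithLp.toLp 2 v))).comp T) w).trans ?_
    refine Finset.sum_eq_zero fun k _ => ?_
    have : ((g.inner (e.symm y) (T (WithLp.toLp 2 v))).comp T) (EuclideanSpace.single k 1) = 0 :=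
      (g.symm _ _ _).trans (hzero k)
    rw [this, mul_zero]
  have h0 : (WithLp.toLp 2 v : Coord n) = 0 := hinj (hu.trans (map_zero T).symm)
  exact hv (by ext i; exact congrFun (congrArg WithLp.ofLp h0) i)

theorem metricCoord_isMetricOn (g : PseudoRiemannianMetric n M)
    (he : e ∈ IsManifold.maximalAtlas (𝓡 n) ∞ M) : IsMetricOn (metricCoord g e) (chartOpens e) :=
  ⟨metricCoord_smooth g he, fun _ _ _ => g.symm _ _ _, fun _ hy => metricCoord_det g he hy⟩

end Charts

/-! ### Functions with vanishing derivatives on intervals and balls. -/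

section TimeSlices

variable {n : ℕ}

theorem hasDerivAt_dt {f : ℝ × Coord n → ℝ} {t : ℝ} {y : Coord n}
    (hf : DifferentiableAt ℝ f (t, y)) : HasDerivAt (fun s => f (s, y)) (dt f (t, y)) t := by
  have h1 : HasFDerivAt (fun s : ℝ => (s, y)) (ContinuousLinearMap.inl ℝ ℝ (Coord n)) t :=
    hasFDerivAt_prodMk_left t y
  have h2 : HasFDerivAt (fun s => f (s, y)) _ t := hf.hasFDerivAt.comp t h1
  have h3 := h2.hasDerivAt
  simpa [dt] using h3

/-- A function on an interval with vanishing derivative in the parameter is constant. -/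
theorem eq_of_dt_eq_zero {J : Set ℝ} {U : Set (Coord n)} (hJ : IsOpen J) (hU : IsOpen U)
    (hJc : IsPreconnected J) {f : ℝ × Coord n → ℝ} (hf : ContDiffOn ℝ ∞ f (J ×ˢ U))
    {y : Coord n} (hy : y ∈ U) (h : ∀ t ∈ J, dt f (t, y) = 0) {s t : ℝ} (hs : s ∈ J)
    (ht : t ∈ J) : f (s, y) = f (t, y) := by
  have hd (t) (ht : t ∈ J) := hasDerivAt_dt (diffAt (hJ.prod hU) hf (q := (t, y)) ⟨ht, hy⟩)
  exact hJ.is_const_of_deriv_eq_zero (f := fun s => f (s, y)) hJc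
    (fun t ht => (hd t ht).differentiableAt.differentiableWithinAt)
    (fun t ht => by rw [(hd t ht).deriv, h t ht]; rfl) hs ht

/-- The parameter derivative is constant on `J`; subtracting the linear function with its value at a
base time `s` as slope leaves a constant. -/
theorem affine_of_dt_dt_eq_zero {J : Set ℝ} {U : Set (Coord n)} (hJ : IsOpen J) (hU : IsOpen U)
    (hJc : IsPreconnected J) {f : ℝ × Coord n → ℝ} (hf : ContDiffOn ℝ ∞ f (J ×ˢ U))
    {y : Coord n} (hy : y ∈ U) (h : ∀ t ∈ J, dt (dt f) (t, y) = 0) :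
    ∃ K L : ℝ, ∀ t ∈ J, f (t, y) = K * t + L := by
  rcases J.eq_empty_or_nonempty with rfl | ⟨s, hs⟩
  · exact ⟨0, 0, by simp⟩
  refine ⟨dt f (s, y), f (s, y) - dt f (s, y) * s, fun t ht => ?_⟩
  have hS := hJ.prod hU
  have hd (r) (hr : r ∈ J) : HasDerivAt (fun r => f (r, y) - dt f (s, y) * r) 0 r := by
    have h1 := (hasDerivAt_dt (diffAt hS hf (q := (r, y)) ⟨hr, hy⟩)).sub
      ((hasDerivAt_id r).const_mul (dt f (s, y)))
    rw [eq_of_dt_eq_zero hJ hU hJc (contDiffOn_dt hS hf) hy h hr hs, mul_one, sub_self] at h1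
    exact h1
  have := hJ.is_const_of_deriv_eq_zero (f := fun r => f (r, y) - dt f (s, y) * r) hJc
    (fun r hr => (hd r hr).differentiableAt.differentiableWithinAt)
    (fun r hr => by rw [(hd r hr).deriv]; rfl) ht hs
  linarith

theorem eq_of_pd_eq_zero {y : Coord n} {r : ℝ} {f : Coord n → ℝ}
    (hf : ∀ z ∈ Metric.ball y r, DifferentiableAt ℝ f z)
    (h : ∀ z ∈ Metric.ball y r, ∀ k, pd k f z = 0) {z : Coord n} (hz : z ∈ Metric.ball y r) :
    f z = f y := by
  refine Metric.isOpen_ball.is_const_of_fderiv_eq_zero (𝕜 := ℝ)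
    (convex_ball y r).isPreconnected (fun z hz => (hf z hz).differentiableWithinAt)
    (fun z hz => ?_) hz (Metric.mem_ball_self (Metric.pos_of_mem_ball hz))
  ext w
  rw [fderiv_eq_sum_pd]
  simp [h z hz]

end TimeSlices

/-! ### Collineations of a proper Einstein manifold. -/

section Global

variable {n : ℕ} {M : Type*} [TopologicalSpace M] [ChartedSpace (Coord n) M]
  [IsManifold (𝓡 n) ∞ M] {g : PseudoRiemannianMetric n M}
  {e : OpenPartialHomeomorph M (Coord n)}

theorem IsProperEinstein.isEinsteinOn (hg : IsProperEinstein g)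
    (he : e ∈ IsManifold.maximalAtlas (𝓡 n) ∞ M) :
    IsEinsteinOn (metricCoord g e) (chartOpens e) := hg e he

theorem IsMetricOn.mono {G : Coord n → Matrix (Fin n) (Fin n) ℝ}
    {U V : TopologicalSpace.Opens (Coord n)} (hG : IsMetricOn G U) (h : V ≤ U) :
    IsMetricOn G V :=
  ⟨fun i j => (hG.smooth i j).mono h, hG.symm, fun y hy => hG.det y (h hy)⟩

theorem IsEinsteinOn.mono {G : Coord n → Matrix (Fin n) (Fin n) ℝ}
    {U V : TopologicalSpace.Opens (Coord n)} (hG : IsEinsteinOn G U) (h : V ≤ U) :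
    IsEinsteinOn G V := fun y hy => hG y (h hy)

theorem IsSmoothField.timeIndependent {X : ∀ x : M, TangentSpace (𝓡 n) x}
    (hX : IsSmoothField X) (J : Set ℝ) :
    ContMDiffOn (𝓘(ℝ, ℝ).prod (𝓡 n)) (𝓡 n).tangent ∞
      (fun p : ℝ × M => (⟨p.2, X p.2⟩ : TangentBundle (𝓡 n) M)) (J ×ˢ Set.univ) :=
  (ContMDiff.comp hX contMDiff_snd).contMDiffOn

theorem IsSmoothField.vecCoord_smooth {X : ∀ x : M, TangentSpace (𝓡 n) x}
    (hX : IsSmoothField X) (he : e ∈ IsManifold.maximalAtlas (𝓡 n) ∞ M) (i : Fin n) :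
    ContDiffOn ℝ ∞ (fun y => vecCoord e X y i) (chartOpens e) := by
  have h := contDiffOn_euclidean.1
    (GeodesicSymmetry.vecCoord_smooth (η := fun _ => X) (hX.timeIndependent Set.univ) he) i
  exact slice_smooth (U := chartOpens e) h (Set.mem_univ (0 : ℝ))

theorem IsAffineCollineation.isKilling (hn : 2 < n) (hg : IsProperEinstein g)
    {X : ∀ x : M, TangentSpace (𝓡 n) x} (hX : IsAffineCollineation g X) : IsKilling g X :=
  ⟨hX.1, fun e he _ hy i j => killing_of_affine hn (metricCoord_isMetricOn g he)
    (hg.isEinsteinOn he) (hX.1.vecCoord_smooth he) (hX.2 e he) hy i j⟩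

theorem IsHomothetic.isAffineCollineation
    {X : ∀ x : M, TangentSpace (𝓡 n) x} {ψ : ℝ} (hX : IsHomothetic g X ψ) :
    IsAffineCollineation g X :=
  ⟨hX.1, fun e he _ hy i j k => affine_of_homothetic (metricCoord_isMetricOn g he)
    (hX.1.vecCoord_smooth he) (hX.2 e he) hy i j k⟩

theorem IsKilling.isHomothetic {X : ∀ x : M, TangentSpace (𝓡 n) x} (hX : IsKilling g X) :
    IsHomothetic g X 0 :=
  ⟨hX.1, fun e he y hy i j => by rw [hX.2 e he y hy i j]; ring⟩

theorem chartAt_mem (x : M) : chartAt (Coord n) x ∈ IsManifold.maximalAtlas (𝓡 n) ∞ M :=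
  IsManifold.chart_mem_maximalAtlas x

/-- The field is affine, hence Killing, so `2 ψ g = 0` at any one point, where `g` is nondegenerate.
-/
theorem IsHomothetic.factor_eq_zero [Nonempty M] (hn : 2 < n) (hg : IsProperEinstein g)
    {X : ∀ x : M, TangentSpace (𝓡 n) x} {ψ : ℝ} (hX : IsHomothetic g X ψ) : ψ = 0 := by
  obtain ⟨x⟩ := ‹Nonempty M›
  have he := chartAt_mem (n := n) x
  have hy := mem_chart_target (Coord n) x
  have hK := hX.isAffineCollineation.isKilling hn hg
  by_contra hψ
  refine metricCoord_det g he hy ?_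
  have : metricCoord g (chartAt (Coord n) x) (chartAt (Coord n) x x) = 0 := by
    ext i j
    have h := hX.2 _ he _ hy i j
    rw [hK.2 _ he _ hy i j] at h
    simpa [hψ] using h
  rw [this]
  -- The zero matrix has determinant 0 only over a nonempty index type.
  have : Nonempty (Fin n) := ⟨⟨0, by omega⟩⟩
  exact Matrix.det_zero

/-- The projective function has zero Hessian, so its differential vanishes and with it the
right-hand side. -/
theorem IsSpecialProjectiveCollineation.isAffineCollineation (hn : 2 < n)
    (hg : IsProperEinstein g) {X : ∀ x : M, TangentSpace (𝓡 n) x}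
    (hX : IsSpecialProjectiveCollineation g X) : IsAffineCollineation g X := by
  refine ⟨hX.1, fun e he y hy i j k => ?_⟩
  obtain ⟨U, f, hU, hyU, hf, h⟩ := hX.2 (e.symm y)
  have hle := chartOpensOver_le (e := e) hU
  have hzero (k) : pd k (fun z => f (e.symm z)) y = 0 :=
    pd_eq_zero_of_covHessian hn ((metricCoord_isMetricOn g he).mono hle)
      ((hg.isEinsteinOn he).mono hle) (scalarCoord_smooth hf he)
      (fun z hz => (h e he z hz.1 hz.2).2) (y := y) ⟨hy, hyU⟩ k
  rw [(h e he y hy hyU).1, hzero, hzero]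
  ring

theorem IsGradientKilling.eq_zero (hn : 2 < n) (hg : IsProperEinstein g)
    {X : ∀ x : M, TangentSpace (𝓡 n) x} (hX : IsGradientKilling g X) (x : M) : X x = 0 := by
  obtain ⟨U, S, hU, hxU, hS, h⟩ := hX.2 x
  set e := chartAt (Coord n) x with hedef
  have he : e ∈ IsManifold.maximalAtlas (𝓡 n) ∞ M := chartAt_mem x
  have hle := chartOpensOver_le (e := e) hU
  have hx : e x ∈ e.target := mem_chart_target (Coord n) x
  have hex : e.symm (e x) = x := e.left_inv (mem_chart_source (Coord n) x)
  have h0 (i) : vecCoord e X (e x) i = 0 :=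
    eq_zero_of_gradient_killing hn ((metricCoord_isMetricOn g he).mono hle)
      ((hg.isEinsteinOn he).mono hle) (fun i => (hX.1.1.vecCoord_smooth he i).mono hle)
      (scalarCoord_smooth hS he) (fun y hy i => h e he y hy.1 hy.2 i)
      (fun y hy => hX.1.2 e he y hy.1) (y := e x) ⟨hx, by simpa [hex] using hxU⟩ i
  have h1 : vecCoord e X (e x) = vecCoord e (fun x => (0 : TangentSpace (𝓡 n) x)) (e x) := by
    ext i
    rw [h0 i, vecCoord, map_zero]
    rfl
  have h2 := vecCoord_injective he hx h1
  rwa [hex] at h2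

/-- The reduced determining equations in all coordinates. -/
theorem isLiePointSymmetry_iff (hn : 2 < n) (hg : IsProperEinstein g) {J : Set ℝ}
    (hJ : IsOpen J) {ξ : ℝ → M → ℝ} {η : ℝ → ∀ x : M, TangentSpace (𝓡 n) x} :
    IsLiePointSymmetry g J ξ η ↔
      ContMDiffOn (𝓘(ℝ, ℝ).prod (𝓡 n)) 𝓘(ℝ, ℝ) ∞ (fun p : ℝ × M => ξ p.1 p.2)
        (J ×ˢ Set.univ) ∧
      ContMDiffOn (𝓘(ℝ, ℝ).prod (𝓡 n)) (𝓡 n).tangent ∞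
        (fun p : ℝ × M => (⟨p.2, η p.1 p.2⟩ : TangentBundle (𝓡 n) M)) (J ×ˢ Set.univ) ∧
      ∀ e ∈ IsManifold.maximalAtlas (𝓡 n) ∞ M, IsReducedSymmetry (metricCoord g e)
        (fun q => ξ q.1 (e.symm q.2)) (fun q => vecCoord e (η q.1) q.2) J (chartOpens e) := by
  refine and_congr_right fun hξ => and_congr_right fun hη => forall₂_congr fun e he => ?_
  exact lieBracket_condition_iff hn hJ (metricCoord_isMetricOn g he) (hg.isEinsteinOn he)
    (scalar_smooth hξ he) (contDiffOn_euclidean.1 (vecCoord_smooth hη he))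

theorem isSmoothField_slice {J : Set ℝ} {η : ℝ → ∀ x : M, TangentSpace (𝓡 n) x}
    (hη : ContMDiffOn (𝓘(ℝ, ℝ).prod (𝓡 n)) (𝓡 n).tangent ∞
        (fun p : ℝ × M => (⟨p.2, η p.1 p.2⟩ : TangentBundle (𝓡 n) M)) (J ×ˢ Set.univ))
    {t : ℝ} (ht : t ∈ J) : IsSmoothField (η t) := by
  have h : ContMDiffOn (𝓡 n) (𝓘(ℝ, ℝ).prod (𝓡 n)) ∞ (fun x : M => (t, x)) Set.univ :=
    contMDiffOn_const.prodMk contMDiffOn_id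
  exact contMDiffOn_univ.1 (hη.comp h fun x _ => ⟨ht, Set.mem_univ x⟩)

/-- The zero vector field is Killing. -/
theorem isKilling_zero : IsKilling g (fun _ => 0) := by
  refine ⟨Bundle.contMDiff_zeroSection ℝ (TangentSpace (𝓡 n) : M → Type _), fun e _ y _ i j => ?_⟩
  have h : vecCoord e (fun x : M => (0 : TangentSpace (𝓡 n) x)) = fun _ => 0 :=
    funext fun y => map_zero _
  simp [lieDerivMetric, h, pd]

/-- A gradient Killing field vanishes identically, so in the classification "non-gradient" adds
nothing to "Killing". -/
theorem IsKilling.isNonGradientKilling (hn : 2 < n) (hg : IsProperEinstein g)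
    {X : ∀ x : M, TangentSpace (𝓡 n) x} (hX : IsKilling g X) : IsNonGradientKilling g X :=
  ⟨hX, fun ⟨x, hx⟩ hgrad => hx (IsGradientKilling.eq_zero hn hg ⟨hX, hgrad⟩ x)⟩

/-- A function with vanishing coordinate derivatives on a connected manifold is constant. -/
theorem eq_of_pd_chart_eq_zero [PreconnectedSpace M] {f : M → ℝ}
    (hf : ∀ e ∈ IsManifold.maximalAtlas (𝓡 n) ∞ M, ∀ y ∈ e.target,
      DifferentiableAt ℝ (fun z => f (e.symm z)) y ∧ ∀ k, pd k (fun z => f (e.symm z)) y = 0)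
    (x x' : M) : f x = f x' := by
  refine IsLocallyConstant.apply_eq_of_preconnectedSpace
    ((IsLocallyConstant.iff_eventually_eq f).2 fun x => ?_) x x'
  set e := chartAt (Coord n) x with hedef
  have he : e ∈ IsManifold.maximalAtlas (𝓡 n) ∞ M := chartAt_mem x
  have hxs : x ∈ e.source := mem_chart_source (Coord n) x
  obtain ⟨r, hr, hball⟩ := Metric.isOpen_iff.1 e.open_target (e x) (e.map_source hxs)
  have hnhds : e ⁻¹' Metric.ball (e x) r ∈ nhds x :=
    (e.continuousAt hxs).preimage_mem_nhds (Metric.ball_mem_nhds _ hr)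
  filter_upwards [hnhds, e.open_source.mem_nhds hxs] with z hz hzs
  have h := eq_of_pd_eq_zero (f := fun z => f (e.symm z)) (fun w hw => (hf e he w (hball hw)).1)
    (fun w hw => (hf e he w (hball hw)).2) hz
  simpa only [e.left_inv hzs, e.left_inv hxs] using h

end Global

/-! ### Classification of the Lie point symmetries. -/

section Classification

variable {n : ℕ} {M : Type*} [TopologicalSpace M] [ChartedSpace (Coord n) M]
  [IsManifold (𝓡 n) ∞ M] {g : PseudoRiemannianMetric n M} {J : Set ℝ} {ξ : ℝ → M → ℝ}
  {η : ℝ → ∀ x : M, TangentSpace (𝓡 n) x}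

/-- From charts to the manifold: `ξ t` is constant by connectedness of `M`, so `K` and `L` can be
read off at a single point; `η t x` is constant in `t` at each point by connectedness of `J`, so `D`
is the slice at a base time `s`. -/
theorem IsLiePointSymmetry.exists_form [ConnectedSpace M] (hn : 2 < n) (hg : IsProperEinstein g)
    (hJ : IsOpen J) (hJc : IsPreconnected J) (h : IsLiePointSymmetry g J ξ η) :
    ∃ (K L : ℝ) (D : ∀ x : M, TangentSpace (𝓡 n) x), IsKilling g D ∧
      ∀ t ∈ J, ∀ x : M, ξ t x = K * t + L ∧ η t x = D x := by
  obtain ⟨hξ, hη, hred⟩ := (isLiePointSymmetry_iff hn hg hJ).1 h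
  rcases J.eq_empty_or_nonempty with rfl | ⟨s, hs⟩
  -- On an empty `J` nothing is asserted about `ξ` and `η`; the zero field serves as `D`.
  · exact ⟨0, 0, fun _ => 0, isKilling_zero, by simp⟩
  obtain ⟨x₀⟩ := (inferInstance : Nonempty M)
  have hconst (t) (ht : t ∈ J) (x : M) : ξ t x = ξ t x₀ := by
    refine eq_of_pd_chart_eq_zero (n := n) (fun e he y hy => ?_) x x₀
    have hsm := slice_smooth (U := chartOpens e) (scalar_smooth hξ he) ht
    refine ⟨differentiableAt_of_contDiffOn e.open_target hsm hy, fun k => ?_⟩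
    rw [← (hred e he).dx_time t ht y hy k]
    exact pd_slice (f := fun q => ξ q.1 (e.symm q.2))
      (diffAt (hJ.prod e.open_target) (scalar_smooth hξ he) ⟨ht, hy⟩) k
  obtain ⟨K, L, hKL⟩ : ∃ K L : ℝ, ∀ t ∈ J, ξ t x₀ = K * t + L := by
    set e := chartAt (Coord n) x₀
    have he : e ∈ IsManifold.maximalAtlas (𝓡 n) ∞ M := chartAt_mem x₀
    have hx : e x₀ ∈ e.target := mem_chart_target (Coord n) x₀
    obtain ⟨K, L, h⟩ := affine_of_dt_dt_eq_zero hJ e.open_target hJc (scalar_smooth hξ he) hx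
      fun t ht => (hred e he).dt_dt_time t ht _ hx
    exact ⟨K, L, fun t ht => (by rw [← h t ht, e.left_inv (mem_chart_source (Coord n) x₀)])⟩
  have hηconst (t) (ht : t ∈ J) (x : M) : η t x = η s x := by
    set e := chartAt (Coord n) x
    have he : e ∈ IsManifold.maximalAtlas (𝓡 n) ∞ M := chartAt_mem x
    have hx : e x ∈ e.target := mem_chart_target (Coord n) x
    have h1 : vecCoord e (η t) (e x) = vecCoord e (η s) (e x) := by
      ext i
      exact eq_of_dt_eq_zero hJ e.open_target hJc
        (contDiffOn_euclidean.1 (vecCoord_smooth hη he) i) hx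
        (fun t ht => (hred e he).dt_space t ht _ hx i) ht hs
    have h2 := vecCoord_injective he hx h1
    rwa [e.left_inv (mem_chart_source (Coord n) x)] at h2
  refine ⟨K, L, η s, ?_, fun t ht x => ⟨(hconst t ht x).trans (hKL t ht), hηconst t ht x⟩⟩
  exact IsAffineCollineation.isKilling hn hg
    ⟨isSmoothField_slice hη hs, fun e he y hy => (hred e he).affine s hs y hy⟩

/-- A Killing field is homothetic with factor 0, hence affine; the other reduced equations are
derivatives of explicit functions. -/
theorem isLiePointSymmetry_of_form (hn : 2 < n) (hg : IsProperEinstein g) (hJ : IsOpen J)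
    {K L : ℝ} {D : ∀ x : M, TangentSpace (𝓡 n) x} (hD : IsKilling g D)
    (h : ∀ t ∈ J, ∀ x : M, ξ t x = K * t + L ∧ η t x = D x) : IsLiePointSymmetry g J ξ η := by
  have hξ : ContMDiffOn (𝓘(ℝ, ℝ).prod (𝓡 n)) 𝓘(ℝ, ℝ) ∞ (fun p : ℝ × M => ξ p.1 p.2)
      (J ×ˢ Set.univ) := by
    have h1 : ContDiff ℝ ∞ fun t : ℝ => K * t + L := by fun_prop
    exact (h1.contMDiff.comp contMDiff_fst).contMDiffOn.congr fun p hp => (h p.1 hp.1 p.2).1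
  have hη : ContMDiffOn (𝓘(ℝ, ℝ).prod (𝓡 n)) (𝓡 n).tangent ∞
      (fun p : ℝ × M => (⟨p.2, η p.1 p.2⟩ : TangentBundle (𝓡 n) M)) (J ×ˢ Set.univ) :=
    (hD.1.timeIndependent J).congr fun p hp => by rw [(h p.1 hp.1 p.2).2]
  refine (isLiePointSymmetry_iff hn hg hJ).2 ⟨hξ, hη, fun e he => ?_⟩
  have hS : IsOpen (J ×ˢ e.target) := hJ.prod e.open_target
  have hξe := scalar_smooth hξ he
  have hdt (t) (ht : t ∈ J) (y) (hy : y ∈ e.target) :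
      dt (fun q : ℝ × Coord n => ξ q.1 (e.symm q.2)) (t, y) = K := by
    refine (hasDerivAt_dt (diffAt hS hξe (q := (t, y)) ⟨ht, hy⟩)).unique ?_
    have h1 : HasDerivAt (fun t : ℝ => K * t + L) K t := by
      simpa using ((hasDerivAt_id t).const_mul K).add_const L
    -- The explicit form holds only for parameters in `J`, which is open, so derivatives are
    -- compared through germs.
    refine h1.congr_of_eventuallyEq ?_
    filter_upwards [hJ.mem_nhds ht] with r hr using (h r hr _).1
  refine ⟨fun t ht y hy k => ?_, fun t ht y hy => ?_, fun t ht y hy i => ?_,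
    fun t ht y hy i j k => ?_⟩
  · have h1 := pd_slice (diffAt hS hξe (q := (t, y)) ⟨ht, hy⟩) k
    rw [← h1]
    have h2 : (fun z => ξ t (e.symm z)) = fun _ => K * t + L := funext fun z => (h t ht _).1
    simp [h2, pd]
  · refine (hasDerivAt_dt (diffAt hS (contDiffOn_dt hS hξe) (q := (t, y)) ⟨ht, hy⟩)).unique ?_
    refine (hasDerivAt_const t K).congr_of_eventuallyEq ?_
    filter_upwards [hJ.mem_nhds ht] with r hr using hdt r hr y hy
  · have hηe := contDiffOn_euclidean.1 (vecCoord_smooth hη he) i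
    refine (hasDerivAt_dt (diffAt hS hηe (q := (t, y)) ⟨ht, hy⟩)).unique ?_
    refine (hasDerivAt_const t (vecCoord e D y i)).congr_of_eventuallyEq ?_
    filter_upwards [hJ.mem_nhds ht] with r hr
    rw [show η r = D from funext fun x => (h r hr x).2]
  · have h1 : η t = D := funext fun x => (h t ht x).2
    simp only [h1]
    exact hD.isHomothetic.isAffineCollineation.2 e he y hy i j k

end Classification

end GeodesicSymmetry

theorem theorem3 {n : ℕ} (hn : 2 < n) {M : Type*} [TopologicalSpace M] [ConnectedSpace M]
    [ChartedSpace (Coord n) M] [IsManifold (𝓡 n) ∞ M]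
    (g : PseudoRiemannianMetric n M) (hg : IsProperEinstein g) :
    (∀ (J : Set ℝ), IsOpen J → IsPreconnected J →
      ∀ (ξ : ℝ → M → ℝ) (η : ℝ → ∀ x : M, TangentSpace (𝓡 n) x),
        IsLiePointSymmetry g J ξ η ↔
          ∃ (K L : ℝ) (D : ∀ x : M, TangentSpace (𝓡 n) x), IsNonGradientKilling g D ∧
            ∀ t ∈ J, ∀ x : M, ξ t x = K * t + L ∧ η t x = D x) ∧
    (∀ (X : ∀ x : M, TangentSpace (𝓡 n) x) (ψ : ℝ), IsHomothetic g X ψ → ψ = 0) ∧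
    (∀ X : ∀ x : M, TangentSpace (𝓡 n) x, IsAffineCollineation g X → IsKilling g X) ∧
    (∀ X : ∀ x : M, TangentSpace (𝓡 n) x, IsSpecialProjectiveCollineation g X → IsKilling g X) ∧
    (∀ X : ∀ x : M, TangentSpace (𝓡 n) x, IsGradientKilling g X → ∀ x, X x = 0) := by
  refine ⟨fun J hJ hJc ξ η => ⟨fun h => ?_, fun ⟨K, L, D, hD, h⟩ =>
    isLiePointSymmetry_of_form hn hg hJ hD.1 h⟩, fun X ψ hX => hX.factor_eq_zero hn hg,
    fun X hX => hX.isKilling hn hg, fun X hX => (hX.isAffineCollineation hn hg).isKilling hn hg,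
    fun X hX => hX.eq_zero hn hg⟩
  obtain ⟨K, L, D, hD, h⟩ := h.exists_form hn hg hJ hJc
  exact ⟨K, L, D, hD.isNonGradientKilling hn hg, h⟩
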